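/- **Setting.** There are $C>1$ cells; in each cell a base station (BS) with $M$ antennas serves $K$ single-antenna users. Let $g_{k,c,c'}\ge 0$ be fixed path gains and let ${\bf h}_{k,c,c'}[t]\in\mathbb C^M$ be the channel vector from BS $c'$ to user $k$ of cell $c$ in slot $t$; all these vectors are independent over $(t,k,c,c')$, with i.i.d. $\mathcal{CN}(0,1)$ components. Put ${\bf H}_c[t]=[{\bf h}_{1,c,c}[t],\dots,{\bf h}_{K,c,c}[t]]$. A scheduling decision for channel matrix ${\bf H}=[{\bf h}_1,\dots,{\bf h}_K]$ is a pair of a power vector ${\bf P}\ge 0$ with $\sum_kP_k\le 1$ and at most $\min\{M,K\}$ active users (those in $\mathcal S=\{k:P_k>0\}$), and a rate vector ${\bf r}\ge 0$. Let ${\bf v}_k$ ($k\in\mathcal S$) be the zero-forcing steering vectors, i.e. the normalized columns of ${\bf H}_{\mathcal S}({\bf H}_{\mathcal S}^{\sf H}{\bf H}_{\mathcal S})^{-1}$, where ${\bf H}_{\mathcal S}$ consists of the columns of ${\bf H}$ in $\mathcal S$; the transmit covariance matrix is $\Sigma=\sum_{k\in\mathcal S}P_k{\bf v}_k{\bf v}_k^{\sf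 H}$. For interference power $\chi$ and gain $g$ let $I_k(g,{\bf H},\chi,\Sigma)=\log_2\bigl(1+\tfrac{g|{\bf h}_k^{\sf H}{\bf v}_k|^2P_k}{1+\chi}\bigr)$ (equal to $0$ if $P_k=0$); the service rate of user $k$ is the outage rate $r_k\,\mathbf 1\{r_k\le I_k\}$. A stationary policy is a (possibly randomized) measurable map from channel matrices to scheduling decisions. Fix a reference cell $c$ and a stationary policy $\gamma_{c'}$ for every other cell $c'\ne c$ (the randomizations being independent over slots and cells and independent of the channels). These fix the joint law of the interference powers $\chi_{k,c}[t]=\sum_{c'\ne c}g_{k,c,c'}{\bf h}_{k,c,c'}^{\sf H}[t]\,\Sigma_{c'}[t]\,{\bf h}_{k,c,c'}[t]$. Let $\mathcal R_c$ be the closure of the convex hull of the union, over all stationary policies of cell $c$, of the sets $\{\overline{\bf R}\in\mathbb R_+^K:\overline R_k\le \mathbb E[\text{service rate of user }k]\ \forall k\}$. Let $U:\mathbb R_+^K\to[-\infty,\infty)$ be continuous (as an extended-real-valued function), concave and entry-wise non-decreasing. **Policy.** Fix $V>0$ and $A_{\max}>0$. The adaptive policy $\gamma_c^\star$ keeps virtual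 queues $Q_k[t]$, with an arbitrary deterministic initial state $Q_k[0]\ge0$. In each slot $t$, for the current ${\bf H}_c[t]$ and ${\bf Q}[t]$, it (1) chooses a scheduling decision that maximizes $\sum_kQ_k[t]\,\mathbb E\bigl[r_k\mathbf 1\{r_k\le I_k(g_{k,c,c},{\bf H}_c[t],\chi_{k,c}[t],\Sigma)\}\,\big|\,{\bf H}_c[t]\bigr]$ (where ${\bf Q}[t]$ and the decision are treated as fixed); (2) chooses ${\bf A}[t]\in[0,A_{\max}]^K$ that maximizes $V\,U({\bf A})-\sum_kA_kQ_k[t]$; and (3) updates $Q_k[t+1]=\max\{0,Q_k[t]-R_k[t]\}+A_k[t]$, where $R_k[t]$ is the service rate obtained in slot $t$. Here ties are broken by any fixed measurable rule depending on $({\bf H}_c[t],{\bf Q}[t])$, respectively on ${\bf Q}[t]$. **Theorem.** Assume that some ${\bf r}\in\mathcal R_c$ with strictly positive entries satisfies $U({\bf r}/2)>-\infty$. Then the problem of maximizing $U$ over $\mathcal R_c\cap[0,A_{\max}]^K$ has a solution, and every solution $\overline{\bf R}^\star(A_{\max})$ has the following properties, where $$\kappa=\frac12\Bigl(KA_{\max}^2+\sum_{k=1}^K\mathbb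 E\Bigl[\log_2^2\Bigl(1+\frac{g_{k,c,c}|{\bf h}_{k,c,c}|^2}{1+\chi_{k,c}}\Bigr)\Bigr]\Bigr).$$ (a) Almost surely, $$\liminf_{t\to\infty}U\Bigl(\frac1t\sum_{\tau=1}^t{\bf R}[\tau]\Bigr)\ \ge\ U(\overline{\bf R}^\star(A_{\max}))-\frac{\kappa}{V}.$$ (b) Suppose that $U(\overline{\bf R}^\star(A_{\max}))>-\infty$ (which holds, for example, if $A_{\max}\ge r_k/2$ for all $k$). Then for every $\overline{\bf R}\in\mathcal R_c\cap[0,A_{\max}]^K$ and every $\beta\in[0,1)$, $$\limsup_{t\to\infty}\frac1t\sum_{\tau=1}^t\sum_{k=1}^K\overline R_k\,\mathbb E[Q_k[\tau]]\ \le\ \frac{\kappa+V\bigl[U(\overline{\bf R}^\star(A_{\max}))-U(\beta\overline{\bf R})\bigr]}{1-\beta}$$ (the right-hand side being $+\infty$ if $U(\beta\overline{\bf R})=-\infty$), and all virtual queues are strongly stable: $\limsup_{t\to\infty}\frac1t\sum_{\tau=1}^t\mathbb E[Q_k[\tau]]<\infty$ for every $k$, all these expectations being finite. -/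

import Mathlib

open MeasureTheory ProbabilityTheory Filter Topology
open scoped NNReal ENNReal Matrix

namespace MultiCell

noncomputable section

/-- The circularly symmetric complex Gaussian law `CN(0,1)`: independent real and imaginary
parts, each of variance `1/2`. -/
def cGauss : Measure ℂ :=
  ((gaussianReal 0 (1 / 2)).prod (gaussianReal 0 (1 / 2))).map
    (fun p : ℝ × ℝ => (⟨p.1, p.2⟩ : ℂ))

/-- The own-cell channel of one slot: `H k` is the channel vector (in `ℂ^M`) of user `k`, that is
the `k`-th column of the `M × K` channel matrix. -/
abbrev Channel (M K : ℕ) := Fin K → Fin M → ℂ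

/-- All the randomness of one slot of a system with `C` cells, `K` users per cell and `M` antennas
per base station (BS): `w.1 k c c'` is the channel vector from BS `c'` to user `(k, c)`, and
`w.2 c'` is the seed that BS `c'` uses to randomize its scheduling decision. -/
abbrev Slot (M K C : ℕ) := (Fin K → Fin C → Fin C → Fin M → ℂ) × (Fin C → unitInterval)

/-- The law of one slot: all channel coefficients are i.i.d. `CN(0,1)`, the seeds are i.i.d. uniform
on `[0,1]`, independent of the channels. -/
def slotLaw (M K C : ℕ) : Measure (Slot M K C) :=
  (Measure.pi fun _ : Fin K => Measure.pi fun _ : Fin C => Measure.pi fun _ : Fin C =>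
      Measure.pi fun _ : Fin M => cGauss).prod
    (Measure.pi fun _ : Fin C => (volume : Measure unitInterval))

/-- The channel matrix of cell `c`. -/
def ownChannel {M K C : ℕ} (c : Fin C) (w : Slot M K C) : Channel M K := fun k => w.1 k c c

/-- The squared Euclidean norm of a vector of `ℂ^M`. -/
def sqNorm {M : ℕ} (x : Fin M → ℂ) : ℝ := ∑ m, ‖x m‖ ^ 2

/-- The (unnormalized) zero-forcing direction of user `k` for the set `S` of active users: the
column belonging to `k` of `H_S (H_Sᴴ H_S)⁻¹`, i.e. of the (conjugate transposed) Moore-Penrose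
pseudoinverse of `H_S`, where `H_S` has the columns `H j`, `j ∈ S`. (For `|S| ≤ M`, `H_S` has full
column rank for almost every `H`; on the remaining null set the value is `0`.) -/
def zfColumn {M K : ℕ} (H : Channel M K) (S : Finset (Fin K)) (k : Fin K) : Fin M → ℂ :=
  let HS : Matrix (Fin M) S ℂ := Matrix.of fun m j => H j.1 m
  if hk : k ∈ S then fun m => (HS * (HSᴴ * HS)⁻¹) m ⟨k, hk⟩ else 0

/-- The unit-norm zero-forcing steering vector. -/
def steering {M K : ℕ} (H : Channel M K) (S : Finset (Fin K)) (k : Fin K) : Fin M → ℂ :=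
  fun m => zfColumn H S k m / ((Real.sqrt (sqNorm (zfColumn H S k)) : ℝ) : ℂ)

/-- A scheduling decision `(P, r)`: the vector of powers and the vector of allocated rates. Together
with the channel matrix, the powers determine the transmit covariance matrix. -/
abbrev Action (K : ℕ) := (Fin K → ℝ) × (Fin K → ℝ)

/-- The set of active users: those with positive power. -/
def active {K : ℕ} (P : Fin K → ℝ) : Finset (Fin K) :=
  Finset.univ.filter fun k => 0 < P k

/-- Feasible scheduling decisions: non-negative powers of sum at most one, at most `min {M, K}`
active users, non-negative rates. -/
def Feasible (M : ℕ) {K : ℕ} (a : Action K) : Prop :=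
  (∀ k, 0 ≤ a.1 k) ∧ ∑ k, a.1 k ≤ 1 ∧ (active a.1).card ≤ min M K ∧ ∀ k, 0 ≤ a.2 k

/-- The transmit covariance matrix `∑ₖ Pₖ vₖ vₖᴴ`. -/
def txCov {M K : ℕ} (H : Channel M K) (P : Fin K → ℝ) : Matrix (Fin M) (Fin M) ℂ :=
  ∑ k, (P k : ℂ) •
    Matrix.vecMulVec (steering H (active P) k) (star (steering H (active P) k))

/-- A feasible (possibly randomized) stationary scheduling policy: a measurable map from the channel
matrix and a uniform seed to feasible decisions. -/
structure Policy (M K : ℕ) where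
  act : Channel M K → unitInterval → Action K
  measurable_act : Measurable fun p : Channel M K × unitInterval => act p.1 p.2
  feasible : ∀ H u, Feasible M (act H u)

/-- The inter-cell interference power at user `(k, c)`, when the BSs `c' ≠ c` apply the policies
`γ`: `∑_{c' ≠ c} g_{k,c,c'} h_{k,c,c'}ᴴ Σ_{c'} h_{k,c,c'}`. -/
def ici {M K C : ℕ} (g : Fin K → Fin C → Fin C → ℝ) (c : Fin C)
    (γ : {c' : Fin C // c' ≠ c} → Policy M K) (w : Slot M K C) (k : Fin K) : ℝ :=
  ∑ c' : {c' : Fin C // c' ≠ c},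
    g k c c' * (star (w.1 k c c') ⬝ᵥ
      (txCov (ownChannel c'.1 w) ((γ c').act (ownChannel c'.1 w) (w.2 c')).1 *ᵥ
        w.1 k c c')).re

/-- The mutual information (in bits) of user `k`, for own path gain `g` and interference power
`χ`. -/
def mutualInfo {M K : ℕ} (g : ℝ) (H : Channel M K) (χ : ℝ) (P : Fin K → ℝ) (k : Fin K) : ℝ :=
  Real.logb 2 (1 + g * ‖star (H k) ⬝ᵥ steering H (active P) k‖ ^ 2 * P k / (1 + χ))

open Classical in
/-- The outage rate `rₖ 1{rₖ ≤ Iₖ}`, the service rate of user `k`. -/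
def outageRate {M K : ℕ} (g : ℝ) (H : Channel M K) (χ : ℝ) (a : Action K) (k : Fin K) : ℝ :=
  if a.2 k ≤ mutualInfo g H χ a.1 k then a.2 k else 0

/-- The throughput of user `k` of cell `c` under the stationary policy `η`, when the other cells
apply `γ`. -/
def throughput {M K C : ℕ} (g : Fin K → Fin C → Fin C → ℝ) (c : Fin C)
    (γ : {c' : Fin C // c' ≠ c} → Policy M K) (η : Policy M K) (k : Fin K) : ℝ :=
  ∫ w, outageRate (g k c c) (ownChannel c w) (ici g c γ w k)
    (η.act (ownChannel c w) (w.2 c)) k ∂(slotLaw M K C)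

/-- The region of achievable throughputs of cell `c`: the closure of the convex hull of the union,
over all feasible stationary policies, of the boxes below the throughput vectors. -/
def region {M K C : ℕ} (g : Fin K → Fin C → Fin C → ℝ) (c : Fin C)
    (γ : {c' : Fin C // c' ≠ c} → Policy M K) : Set (Fin K → ℝ) :=
  closure (convexHull ℝ (⋃ η : Policy M K,
    {R : Fin K → ℝ | ∀ k, 0 ≤ R k ∧ R k ≤ throughput g c γ η k}))

/-- The box `[0, A]^K`. -/
def box (K : ℕ) (A : ℝ) : Set (Fin K → ℝ) := {x | ∀ k, 0 ≤ x k ∧ x k ≤ A}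

/-- `R` solves: maximize `U` over the throughput region intersected with `[0, A]^K`. -/
def IsBoxOptimal {M K C : ℕ} (g : Fin K → Fin C → Fin C → ℝ) (c : Fin C)
    (γ : {c' : Fin C // c' ≠ c} → Policy M K) (U : (Fin K → ℝ) → EReal) (A : ℝ)
    (R : Fin K → ℝ) : Prop :=
  R ∈ region g c γ ∩ box K A ∧ ∀ x ∈ region g c γ ∩ box K A, U x ≤ U R

/-- Concavity on the non-negative orthant of a function with values in `[-∞, ∞)`. -/
def ConcaveOnOrthant {K : ℕ} (U : (Fin K → ℝ) → EReal) : Prop :=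
  ∀ x y : Fin K → ℝ, 0 ≤ x → 0 ≤ y → ∀ a b : ℝ, 0 ≤ a → 0 ≤ b → a + b = 1 →
    (a : EReal) * U x + (b : EReal) * U y ≤ U (a • x + b • y)

/-- The weighted conditional average sum rate `∑ₖ qₖ E[rₖ 1{rₖ ≤ Iₖ} | H]` of the decision `a`. As
the interference powers are independent of the own channel matrix, the conditional expectation given
`H` is the expectation over the interference powers alone. -/
def weightedRate {M K C : ℕ} (g : Fin K → Fin C → Fin C → ℝ) (c : Fin C)
    (γ : {c' : Fin C // c' ≠ c} → Policy M K) (H : Channel M K) (q : Fin K → ℝ)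
    (a : Action K) : ℝ :=
  ∑ k, q k * ∫ w, outageRate (g k c c) H (ici g c γ w k) a k ∂(slotLaw M K C)

/-- The adaptive policy with parameters `V` and `A` (any measurable choice of the solutions of its
two maximization problems). In each slot, given the channel matrix `H` (up to a null set) and the
virtual queues `q`, the decision maximizes the weighted conditional average sum rate, and the virtual arrivals
maximize `V U(x) - ∑ₖ xₖ qₖ` over `[0, A]^K`. -/
structure AdaptivePolicy {M K C : ℕ} (g : Fin K → Fin C → Fin C → ℝ) (c : Fin C)
    (γ : {c' : Fin C // c' ≠ c} → Policy M K) (U : (Fin K → ℝ) → EReal) (V A : ℝ) where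
  act : Channel M K → (Fin K → ℝ) → Action K
  arrival : (Fin K → ℝ) → (Fin K → ℝ)
  measurable_act : Measurable fun p : Channel M K × (Fin K → ℝ) => act p.1 p.2
  measurable_arrival : Measurable arrival
  feasible : ∀ H q, Feasible M (act H q)
  act_optimal : ∀ᵐ H ∂((slotLaw M K C).map (ownChannel c)),
    ∀ q : Fin K → ℝ, 0 ≤ q → ∀ a : Action K, Feasible M a →
    weightedRate g c γ H q a ≤ weightedRate g c γ H q (act H q)
  arrival_mem : ∀ q, arrival q ∈ box K A
  arrival_optimal : ∀ q : Fin K → ℝ, 0 ≤ q → ∀ x ∈ box K A,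
    (V : EReal) * U x - ((∑ k, x k * q k : ℝ) : EReal) ≤
      (V : EReal) * U (arrival q) - ((∑ k, arrival q k * q k : ℝ) : EReal)

/-- The virtual queues `Q[t]` along a sequence `w` of slots, from the initial state `q₀`:
`Qₖ[t+1] = max {0, Qₖ[t] - Rₖ[t]} + Aₖ[t]`. -/
def AdaptivePolicy.queue {M K C : ℕ} {g : Fin K → Fin C → Fin C → ℝ} {c : Fin C}
    {γ : {c' : Fin C // c' ≠ c} → Policy M K} {U : (Fin K → ℝ) → EReal} {V A : ℝ}
    (π : AdaptivePolicy g c γ U V A) (q₀ : Fin K → ℝ) (w : ℕ → Slot M K C) :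
    ℕ → Fin K → ℝ
  | 0 => q₀
  | t + 1 => fun k =>
      max 0 (π.queue q₀ w t k -
        outageRate (g k c c) (ownChannel c (w t)) (ici g c γ (w t) k)
          (π.act (ownChannel c (w t)) (π.queue q₀ w t)) k)
      + π.arrival (π.queue q₀ w t) k

/-- The service rates `R[t]` under the adaptive policy. -/
def AdaptivePolicy.rate {M K C : ℕ} {g : Fin K → Fin C → Fin C → ℝ} {c : Fin C}
    {γ : {c' : Fin C // c' ≠ c} → Policy M K} {U : (Fin K → ℝ) → EReal} {V A : ℝ}
    (π : AdaptivePolicy g c γ U V A) (q₀ : Fin K → ℝ) (w : ℕ → Slot M K C)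
    (t : ℕ) (k : Fin K) : ℝ :=
  outageRate (g k c c) (ownChannel c (w t)) (ici g c γ (w t) k)
    (π.act (ownChannel c (w t)) (π.queue q₀ w t)) k

/-- The constant `κ`. -/
def kappa {M K C : ℕ} (g : Fin K → Fin C → Fin C → ℝ) (c : Fin C)
    (γ : {c' : Fin C // c' ≠ c} → Policy M K) (A : ℝ) : ℝ :=
  (1 / 2) * ((K : ℝ) * A ^ 2 + ∑ k, ∫ w,
    (Real.logb 2 (1 + g k c c * sqNorm (w.1 k c c) / (1 + ici g c γ w k))) ^ 2
      ∂(slotLaw M K C))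

/-- Strong stability of a queue: its time-averaged expected size has a finite limsup. -/
def StronglyStable {Ω : Type*} [MeasurableSpace Ω] (μ : Measure Ω) (Q : ℕ → Ω → ℝ) : Prop :=
  (∀ t, Integrable (Q t) μ) ∧
    limsup (fun t : ℕ =>
      (((1 / (t : ℝ)) * ∑ τ ∈ Finset.Icc 1 t, ∫ ω, Q τ ω ∂μ : ℝ) : EReal)) atTop < ⊤

end

end MultiCell

/-!
Let `L(q) = ∑ₖ qₖ²`. Since the interference is independent of the own-cell channels, the scheduling
decision is max-weight: the mean service rates maximize `∑ₖ qₖ Rₖ` over the throughput region.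
Together with the choice of the arrivals, this bounds the drift of `L / 2` minus `V` times the
utility of the arrivals by `κ` minus the same expression at any target point; averaging over time
gives the utility and the queue bounds in expectation.

For the almost sure statement, a point of the region that strictly dominates a target of finite
utility makes the drift of `L²` at most a constant minus `L`; the fourth moments of the rates are
finite. Hence the time averages of `E[L(Q[t])]` are bounded, so that `∑ₜ E[L(Q[t])] / t² < ∞`. This
yields both `Q[t] / t → 0` and the strong law for the martingale part of the drift. The queue
recursion turns `Q[t] / t → 0` into asymptotic domination of the average arrivals by the average
rates, and Jensen's inequality for `U` concludes.
-/

namespace MultiCell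

section Sequences

variable {F : Type*} [NormedAddCommGroup F] [NormedSpace ℝ F]

theorem sum_range_eq_smul_sub_sum_partialSum (d : ℕ → F) (n : ℕ) :
    ∑ i ∈ Finset.range n, d i =
      (n : ℝ) • ∑ i ∈ Finset.range n, ((i : ℝ) + 1)⁻¹ • d i -
        ∑ m ∈ Finset.range n, ∑ i ∈ Finset.range m, ((i : ℝ) + 1)⁻¹ • d i := by
  induction n with
  | zero => simp
  | succ n ih =>
    have hn : (n : ℝ) + 1 ≠ 0 := by positivity
    rw [Finset.sum_range_succ, ih, Finset.sum_range_succ _ n,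
      Finset.sum_range_succ (fun m => ∑ i ∈ Finset.range m, ((i : ℝ) + 1)⁻¹ • d i),
      Nat.cast_succ, smul_add, smul_inv_smul₀ hn, add_smul, one_smul]
    abel

/-- Kronecker's lemma for the weights `n + 1`. -/
theorem tendsto_cesaro_zero_of_tendsto_sum {d : ℕ → F} {l : F}
    (h : Tendsto (fun n => ∑ i ∈ Finset.range n, ((i : ℝ) + 1)⁻¹ • d i) atTop (𝓝 l)) :
    Tendsto (fun n : ℕ => (n : ℝ)⁻¹ • ∑ i ∈ Finset.range n, d i) atTop (𝓝 0) := by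
  rw [← sub_self l]
  refine (h.sub h.cesaro_smul).congr' ?_
  filter_upwards [eventually_ne_atTop 0] with n hn
  rw [sum_range_eq_smul_sub_sum_partialSum d, smul_sub,
    inv_smul_smul₀ (Nat.cast_ne_zero.2 hn)]

/-- The average of `f` over the slots `1, …, n`; it is `0` for `n = 0`. -/
noncomputable def timeAverage (f : ℕ → F) (n : ℕ) : F :=
  (1 / (n : ℝ)) • ∑ τ ∈ Finset.Icc 1 n, f τ

theorem timeAverage_mem {S : Set F} (hS : Convex ℝ S) {f : ℕ → F} (hf : ∀ τ, f τ ∈ S) {n : ℕ}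
    (hn : n ≠ 0) : timeAverage f n ∈ S := by
  rw [timeAverage, Finset.smul_sum]
  exact hS.sum_mem (fun _ _ => by positivity) (by simp [hn]) fun τ _ => hf τ

theorem timeAverage_add (f g : ℕ → F) (n : ℕ) :
    timeAverage (fun τ => f τ + g τ) n = timeAverage f n + timeAverage g n := by
  simp only [timeAverage, Finset.sum_add_distrib, smul_add]

theorem timeAverage_sub (f g : ℕ → F) (n : ℕ) :
    timeAverage (fun τ => f τ - g τ) n = timeAverage f n - timeAverage g n := by
  simp only [timeAverage, Finset.sum_sub_distrib, smul_sub]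

theorem timeAverage_mul_left (a : ℝ) (f : ℕ → ℝ) (n : ℕ) :
    timeAverage (fun τ => a * f τ) n = a * timeAverage f n := by
  simp only [timeAverage, ← Finset.mul_sum, smul_eq_mul, mul_left_comm]

theorem timeAverage_mono [PartialOrder F] [IsOrderedAddMonoid F] [PosSMulMono ℝ F]
    {f g : ℕ → F} (h : ∀ τ, f τ ≤ g τ) (n : ℕ) : timeAverage f n ≤ timeAverage g n :=
  smul_le_smul_of_nonneg_left (Finset.sum_le_sum fun τ _ => h τ) (by positivity)

theorem timeAverage_const (a : F) {n : ℕ} (hn : n ≠ 0) : timeAverage (fun _ => a) n = a :=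
  timeAverage_mem (convex_singleton a) (fun _ => Set.mem_singleton a) hn

theorem timeAverage_sub_succ (f : ℕ → F) (n : ℕ) :
    timeAverage (fun τ => f (τ + 1) - f τ) n = (1 / (n : ℝ)) • (f (n + 1) - f 1) := by
  rw [timeAverage, ← Finset.Ico_succ_right_eq_Icc, Finset.sum_Ico_sub f (by simp)]
  rfl

theorem neg_smul_le_timeAverage_of_sub_le [PartialOrder F] [IsOrderedAddMonoid F]
    [PosSMulMono ℝ F] {f c : ℕ → F} (hf : ∀ t, 0 ≤ f t) (h : ∀ t, f (t + 1) - f t ≤ c t) (n : ℕ) :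
    -((1 / (n : ℝ)) • f 1) ≤ timeAverage c n := by
  refine le_trans ?_ (timeAverage_mono h n)
  rw [timeAverage_sub_succ, smul_sub, neg_le_sub_iff_le_add, ← sub_nonneg, add_sub_cancel_right]
  exact smul_nonneg (by positivity) (hf (n + 1))

theorem timeAverage_le_timeAverage_add_smul [PartialOrder F] [IsOrderedAddMonoid F]
    [PosSMulMono ℝ F] {f g q : ℕ → F} (hq : ∀ t, 0 ≤ q t)
    (h : ∀ t, f t - g t ≤ q (t + 1) - q t) (n : ℕ) :
    timeAverage f n ≤ timeAverage g n + (1 / (n : ℝ)) • q (n + 1) := by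
  have havg := timeAverage_mono h n
  rw [timeAverage_sub, timeAverage_sub_succ, sub_le_iff_le_add'] at havg
  exact havg.trans (add_le_add_right
    (smul_le_smul_of_nonneg_left (sub_le_self _ (hq 1)) (by positivity)) _)

theorem timeAverage_prodMk {F' : Type*} [NormedAddCommGroup F'] [NormedSpace ℝ F']
    (f : ℕ → F) (g : ℕ → F') (n : ℕ) :
    timeAverage (fun τ => (f τ, g τ)) n = (timeAverage f n, timeAverage g n) := by
  simp [timeAverage, Prod.ext_iff, Prod.fst_sum, Prod.snd_sum]

theorem timeAverage_apply {ι : Type*} [Fintype ι] (f : ℕ → ι → ℝ) (n : ℕ) (i : ι) :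
    timeAverage f n i = timeAverage (fun τ => f τ i) n := by
  simp [timeAverage]

theorem tendsto_timeAverage_of_tendsto_cesaro {f : ℕ → F} {l : F}
    (h : Tendsto (fun n : ℕ => (n : ℝ)⁻¹ • ∑ i ∈ Finset.range n, f i) atTop (𝓝 l)) :
    Tendsto (timeAverage f) atTop (𝓝 l) := by
  have hratio : Tendsto (fun n : ℕ => ((n + 1 : ℕ) : ℝ) / (n : ℝ)) atTop (𝓝 1) := by
    simpa using (tendsto_natCast_div_add_atTop (1 : ℝ)).inv₀ one_ne_zero
  have hfirst : Tendsto (fun n : ℕ => (1 / (n : ℝ)) • f 0) atTop (𝓝 0) := by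
    simpa using (tendsto_one_div_atTop_nhds_zero_nat (𝕜 := ℝ)).smul_const (f 0)
  have hlim := (hratio.smul ((tendsto_add_atTop_iff_nat 1).2 h)).sub hfirst
  rw [one_smul, sub_zero] at hlim
  refine hlim.congr fun n => ?_
  have hsum : ∑ i ∈ Finset.range (n + 1), f i = f 0 + ∑ τ ∈ Finset.Icc 1 n, f τ := by
    rw [Finset.range_eq_Ico, Finset.sum_eq_sum_Ico_succ_bot n.succ_pos]
    rfl
  rw [hsum, smul_smul, div_mul_eq_mul_div, mul_inv_cancel₀ (by positivity), smul_add,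
    add_sub_cancel_left, timeAverage]

theorem sum_mul_antitone_le_of_drift {a b w : ℕ → ℝ} {c : ℝ} (hb : ∀ t, 0 ≤ b t)
    (hw : ∀ t, 0 ≤ w t) (hw_anti : Antitone w) (h : ∀ t, a t ≤ b t - b (t + 1) + c) (n : ℕ) :
    ∑ t ∈ Finset.range n, a t * w t ≤
      b 0 * w 0 - b n * w n + c * ∑ t ∈ Finset.range n, w t := by
  induction n with
  | zero => simp
  | succ n ih =>
    rw [Finset.sum_range_succ, Finset.sum_range_succ]
    have hstep := mul_le_mul_of_nonneg_right (h n) (hw n)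
    have hweight := mul_le_mul_of_nonneg_left (hw_anti n.le_succ) (hb (n + 1))
    linarith

theorem summable_mul_of_drift {a b w : ℕ → ℝ} {c : ℝ} (ha : ∀ t, 0 ≤ a t) (hb : ∀ t, 0 ≤ b t)
    (hw : ∀ t, 0 ≤ w t) (hw_anti : Antitone w) (hw_sum : Summable w) (hc : 0 ≤ c)
    (h : ∀ t, a t ≤ b t - b (t + 1) + c) : Summable fun t => a t * w t := by
  refine summable_of_sum_range_le (c := b 0 * w 0 + c * ∑' t, w t)
    (fun t => mul_nonneg (ha t) (hw t)) fun n =>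
      (sum_mul_antitone_le_of_drift hb hw hw_anti h n).trans ?_
  have htsum := mul_le_mul_of_nonneg_left (hw_sum.sum_le_tsum (Finset.range n) fun i _ => hw i) hc
  have hlast := mul_nonneg (hb n) (hw n)
  linarith

theorem summable_inv_succ_sq : Summable fun t : ℕ => (((t : ℝ) + 1) ^ 2)⁻¹ := by
  simpa using (summable_nat_add_iff 1).2 (Real.summable_nat_pow_inv.2 one_lt_two)

theorem antitone_inv_succ_sq : Antitone fun t : ℕ => (((t : ℝ) + 1) ^ 2)⁻¹ :=
  antitone_nat_of_succ_le fun t => by push_cast; gcongr; linarith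

theorem tendsto_succ_div_of_summable_sq {a : ℕ → ℝ}
    (h : Summable fun t => a t ^ 2 * (((t : ℝ) + 1) ^ 2)⁻¹) :
    Tendsto (fun n : ℕ => a (n + 1) / n) atTop (𝓝 0) := by
  have hdiv : Tendsto (fun t : ℕ => a t / ((t : ℝ) + 1)) atTop (𝓝 0) := by
    rw [tendsto_zero_iff_abs_tendsto_zero]
    simpa [Function.comp_def, ← div_eq_mul_inv, ← div_pow, Real.sqrt_sq_eq_abs] using
      h.tendsto_atTop_zero.sqrt
  have hratio : Tendsto (fun n : ℕ => ((n : ℝ) + 2) / n) atTop (𝓝 1) := by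
    simpa using (tendsto_natCast_div_add_atTop (2 : ℝ)).inv₀ one_ne_zero
  have hmul := ((tendsto_add_atTop_iff_nat 1).2 hdiv).mul hratio
  rw [zero_mul] at hmul
  refine hmul.congr fun n => ?_
  have hn : (n : ℝ) + 2 ≠ 0 := by positivity
  rw [div_mul_div_comm]
  push_cast
  rw [add_assoc, one_add_one_eq_two, mul_comm (a _), mul_div_mul_left _ _ hn]

end Sequences

section Martingale

variable {Ω : Type*} {m0 : MeasurableSpace Ω} {μ : Measure Ω}

theorem ae_summable_of_summable_integral {f : ℕ → Ω → ℝ} (hf : ∀ n, 0 ≤ f n)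
    (hint : ∀ n, Integrable (f n) μ) (hs : Summable fun n => ∫ ω, f n ω ∂μ) :
    ∀ᵐ ω ∂μ, Summable fun n => f n ω := by
  have hmeas : ∀ n, AEMeasurable (fun ω => ENNReal.ofReal (f n ω)) μ := fun n =>
    (hint n).aemeasurable.ennreal_ofReal
  have hfinite : ∫⁻ ω, ∑' n, ENNReal.ofReal (f n ω) ∂μ ≠ ∞ := by
    rw [lintegral_tsum hmeas]
    simp_rw [← ofReal_integral_eq_lintegral_ofReal (hint _) (ae_of_all _ (hf _))]
    exact hs.tsum_ofReal_ne_top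
  filter_upwards [ae_lt_top' (AEMeasurable.tsum hmeas) hfinite] with ω hω
  exact (ENNReal.summable_toReal hω.ne).congr fun n => ENNReal.toReal_ofReal (hf n ω)

theorem integral_mul_eq_zero_of_condExp_eq_zero [IsFiniteMeasure μ] {m : MeasurableSpace Ω}
    (hm : m ≤ m0) {X Y : Ω → ℝ} (hX : StronglyMeasurable[m] X) (hX2 : MemLp X 2 μ)
    (hY2 : MemLp Y 2 μ) (hY : μ[Y | m] =ᵐ[μ] 0) : ∫ ω, X ω * Y ω ∂μ = 0 := by
  have hcond : μ[X * Y | m] =ᵐ[μ] 0 :=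
    (condExp_mul_of_stronglyMeasurable_left hX (hX2.integrable_mul hY2)
      (hY2.integrable one_le_two)).trans (hY.mono fun ω hω => by simp [hω])
  have hint := integral_condExp (μ := μ) (f := X * Y) hm
  rw [integral_congr_ae hcond] at hint
  simpa using hint.symm

/-- Square integrable martingale differences, where `d t` is revealed at time `t + 1`. -/
structure IsMartingaleDifference (ℱ : Filtration ℕ m0) (d : ℕ → Ω → ℝ) (μ : Measure Ω) :
    Prop where
  stronglyMeasurable : ∀ t, StronglyMeasurable[ℱ (t + 1)] (d t)
  memLp_two : ∀ t, MemLp (d t) 2 μ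
  condExp_eq_zero : ∀ t, μ[d t | ℱ t] =ᵐ[μ] 0

namespace IsMartingaleDifference

variable {ℱ : Filtration ℕ m0} {d : ℕ → Ω → ℝ}

theorem const_mul (hd : IsMartingaleDifference ℱ d μ) (a : ℕ → ℝ) :
    IsMartingaleDifference ℱ (fun t ω => a t * d t ω) μ where
  stronglyMeasurable t := (hd.stronglyMeasurable t).const_mul (a t)
  memLp_two t := (hd.memLp_two t).const_mul (a t)
  condExp_eq_zero t := by
    refine (condExp_smul (a t) (d t) (ℱ t)).trans ?_
    filter_upwards [hd.condExp_eq_zero t] with ω hω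
    simp [hω]

theorem stronglyMeasurable_sum (hd : IsMartingaleDifference ℱ d μ) (n : ℕ) :
    StronglyMeasurable[ℱ n] fun ω => ∑ i ∈ Finset.range n, d i ω :=
  Finset.stronglyMeasurable_fun_sum _ fun i hi =>
    (hd.stronglyMeasurable i).mono (ℱ.mono (Finset.mem_range.1 hi))

theorem memLp_two_sum (hd : IsMartingaleDifference ℱ d μ) (n : ℕ) :
    MemLp (fun ω => ∑ i ∈ Finset.range n, d i ω) 2 μ :=
  memLp_finsetSum _ fun i _ => hd.memLp_two i

variable [IsProbabilityMeasure μ]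

theorem integral_sum_sq (hd : IsMartingaleDifference ℱ d μ) (n : ℕ) :
    ∫ ω, (∑ i ∈ Finset.range n, d i ω) ^ 2 ∂μ = ∑ i ∈ Finset.range n, ∫ ω, d i ω ^ 2 ∂μ := by
  induction n with
  | zero => simp
  | succ n ih =>
    have horth := integral_mul_eq_zero_of_condExp_eq_zero (ℱ.le n) (hd.stronglyMeasurable_sum n)
      (hd.memLp_two_sum n) (hd.memLp_two n) (hd.condExp_eq_zero n)
    have hsum := (hd.memLp_two_sum n).integrable_sq
    have hcross := ((hd.memLp_two_sum n).integrable_mul (hd.memLp_two n)).const_mul 2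
    simp only [Pi.mul_apply] at hcross
    simp_rw [Finset.sum_range_succ, add_sq, mul_assoc (2 : ℝ)]
    rw [integral_add (by exact hsum.add hcross) (hd.memLp_two n).integrable_sq,
      integral_add hsum hcross, integral_const_mul, horth, ih, mul_zero, add_zero]

theorem martingale_sum (hd : IsMartingaleDifference ℱ d μ) :
    Martingale (fun n ω => ∑ i ∈ Finset.range n, d i ω) ℱ μ := by
  refine martingale_of_condExp_sub_eq_zero_nat hd.stronglyMeasurable_sum
    (fun n => (hd.memLp_two_sum n).integrable one_le_two) fun n => ?_
  convert hd.condExp_eq_zero n using 2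
  ext ω
  simp [Finset.sum_range_succ]

theorem ae_tendsto_sum (hd : IsMartingaleDifference ℱ d μ)
    (hs : Summable fun t => ∫ ω, d t ω ^ 2 ∂μ) :
    ∀ᵐ ω ∂μ, ∃ l, Tendsto (fun n => ∑ i ∈ Finset.range n, d i ω) atTop (𝓝 l) := by
  refine hd.martingale_sum.submartingale.exists_ae_tendsto_of_bdd
    (R := Real.toNNReal (1 + ∑' t, ∫ ω, d t ω ^ 2 ∂μ)) fun n => ?_
  have hint := (hd.memLp_two_sum n).integrable one_le_two
  have hsq := (hd.memLp_two_sum n).integrable_sq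
  rw [eLpNorm_one_eq_lintegral_enorm, ← ofReal_integral_norm_eq_lintegral_enorm hint]
  refine ENNReal.ofReal_le_ofReal ?_
  calc ∫ ω, ‖∑ i ∈ Finset.range n, d i ω‖ ∂μ
      ≤ ∫ ω, (1 + (∑ i ∈ Finset.range n, d i ω) ^ 2) ∂μ := by
        refine integral_mono hint.norm ((integrable_const 1).add hsq) fun ω => ?_
        simp only [Real.norm_eq_abs]
        nlinarith [sq_nonneg (|∑ i ∈ Finset.range n, d i ω| - 1),
          sq_abs (∑ i ∈ Finset.range n, d i ω)]
    _ = 1 + ∑ t ∈ Finset.range n, ∫ ω, d t ω ^ 2 ∂μ := by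
        rw [integral_add (integrable_const 1) hsq, hd.integral_sum_sq]
        simp
    _ ≤ 1 + ∑' t, ∫ ω, d t ω ^ 2 ∂μ := by
        gcongr
        exact hs.sum_le_tsum _ fun t _ => integral_nonneg fun ω => sq_nonneg _

theorem ae_tendsto_cesaro_zero (hd : IsMartingaleDifference ℱ d μ)
    (hs : Summable fun t : ℕ => (∫ ω, d t ω ^ 2 ∂μ) * (((t : ℝ) + 1) ^ 2)⁻¹) :
    ∀ᵐ ω ∂μ, Tendsto (fun n : ℕ => (n : ℝ)⁻¹ • ∑ i ∈ Finset.range n, d i ω) atTop (𝓝 0) := by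
  have hs' : Summable fun t : ℕ => ∫ ω, (((t : ℝ) + 1)⁻¹ * d t ω) ^ 2 ∂μ := by
    simpa only [mul_pow, inv_pow, mul_comm (_⁻¹), integral_mul_const] using hs
  filter_upwards [(hd.const_mul fun t => ((t : ℝ) + 1)⁻¹).ae_tendsto_sum hs'] with ω ⟨l, hl⟩
  exact tendsto_cesaro_zero_of_tendsto_sum hl

end IsMartingaleDifference

end Martingale

section IID

variable {Ω E α : Type*} {m0 : MeasurableSpace Ω} [MeasurableSpace E] [MeasurableSpace α]
  {μ : Measure Ω} {ν : Measure E} {W : ℕ → Ω → E}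

/-- `W 0, W 1, …` are independent random variables, each of law `ν`. -/
structure IsIID (W : ℕ → Ω → E) (ν : Measure E) (μ : Measure Ω) : Prop where
  measurable : ∀ t, Measurable (W t)
  map_eq : ∀ t, μ.map (W t) = ν
  iIndepFun : iIndepFun W μ

/-- The filtration of the information available strictly before slot `t`: it does not contain
`W t`. -/
def past (W : ℕ → Ω → E) (hW : ∀ t, Measurable (W t)) : Filtration ℕ m0 where
  seq t := ⨆ s ∈ Set.Iio t, MeasurableSpace.comap (W s) inferInstance
  mono' _ _ hst := biSup_mono fun _ hi => lt_of_lt_of_le hi hst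
  le' _ := iSup₂_le fun s _ => (hW s).comap_le

theorem measurable_past_succ (hW : ∀ t, Measurable (W t)) (t : ℕ) :
    Measurable[past W hW (t + 1)] (W t) :=
  (comap_measurable (W t)).mono
    (le_iSup₂ (f := fun s (_ : s ∈ Set.Iio (t + 1)) =>
      MeasurableSpace.comap (W s) inferInstance) t t.lt_succ_self) le_rfl

theorem IsIID.indepFun_past (h : IsIID W ν μ) {t : ℕ} {X : Ω → α}
    (hX : Measurable[past W h.measurable t] X) : X ⟂ᵢ[μ] W t := by
  have hind := indep_iSup_of_disjoint (fun s => (h.measurable s).comap_le) h.iIndepFun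
    (S := Set.Iio t) (T := {t}) (by simp)
  simp only [Set.mem_singleton_iff, iSup_iSup_eq_left] at hind
  exact (IndepFun_iff_Indep _ _ _).2 (indep_of_indep_of_le_left hind hX.comap_le)

theorem IsIID.integrable_comp (h : IsIID W ν μ) {f : E → ℝ} (hf : Integrable f ν) (t : ℕ) :
    Integrable (fun ω => f (W t ω)) μ := by
  rw [← h.map_eq t] at hf
  exact hf.comp_measurable (h.measurable t)

theorem IsIID.integral_comp_eq (h : IsIID W ν μ) {f : E → ℝ} (hf : Measurable f) (t : ℕ) :
    ∫ ω, f (W t ω) ∂μ = ∫ w, f w ∂ν := by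
  rw [← h.map_eq t, integral_map (h.measurable t).aemeasurable hf.aestronglyMeasurable]

theorem IsIID.ae_tendsto_timeAverage (h : IsIID W ν μ) {f : E → ℝ} (hf : Measurable f)
    (hint : Integrable f ν) :
    ∀ᵐ ω ∂μ, Tendsto (timeAverage fun t => f (W t ω)) atTop (𝓝 (∫ w, f w ∂ν)) := by
  have hlln := strong_law_ae (μ := μ) (fun t ω => f (W t ω)) (h.integrable_comp hint 0)
    (fun s t hst => (h.iIndepFun.indepFun hst).comp hf hf) fun t =>
      IdentDistrib.comp (u := f) ⟨(h.measurable t).aemeasurable, (h.measurable 0).aemeasurable,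
        (h.map_eq t).trans (h.map_eq 0).symm⟩ hf
  rw [h.integral_comp_eq hf 0] at hlln
  exact hlln.mono fun ω hω => tendsto_timeAverage_of_tendsto_cesaro hω

variable [IsProbabilityMeasure μ] {X : Ω → α} {Y : Ω → E} {G : α × E → ℝ}

theorem integrable_prod_map_of_indepFun (hX : Measurable X) (hY : Measurable Y)
    (hXY : X ⟂ᵢ[μ] Y) (hG : Measurable G) (hint : Integrable (fun ω => G (X ω, Y ω)) μ) :
    Integrable G ((μ.map X).prod (μ.map Y)) := by
  rw [← (indepFun_iff_map_prod_eq_prod_map_map hX.aemeasurable hY.aemeasurable).1 hXY]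
  exact (integrable_map_measure hG.aestronglyMeasurable (hX.prodMk hY).aemeasurable).2 hint

theorem integrable_integral_of_indepFun (hX : Measurable X) (hY : Measurable Y)
    (hXY : X ⟂ᵢ[μ] Y) (hG : Measurable G) (hint : Integrable (fun ω => G (X ω, Y ω)) μ) :
    Integrable (fun ω => ∫ y, G (X ω, y) ∂(μ.map Y)) μ := by
  have := Measure.isProbabilityMeasure_map (μ := μ) hY.aemeasurable
  have hinner := (integrable_prod_map_of_indepFun hX hY hXY hG hint).integral_prod_left
  exact (integrable_map_measure hinner.aestronglyMeasurable hX.aemeasurable).1 hinner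

theorem integral_comp_of_indepFun (hX : Measurable X) (hY : Measurable Y)
    (hXY : X ⟂ᵢ[μ] Y) (hG : Measurable G) (hint : Integrable (fun ω => G (X ω, Y ω)) μ) :
    ∫ ω, G (X ω, Y ω) ∂μ = ∫ ω, ∫ y, G (X ω, y) ∂(μ.map Y) ∂μ := by
  have := Measure.isProbabilityMeasure_map (μ := μ) hX.aemeasurable
  have := Measure.isProbabilityMeasure_map (μ := μ) hY.aemeasurable
  have hprod := integrable_prod_map_of_indepFun hX hY hXY hG hint
  rw [← integral_map (φ := fun ω => (X ω, Y ω)) (hX.prodMk hY).aemeasurable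
      hG.aestronglyMeasurable,
    (indepFun_iff_map_prod_eq_prod_map_map hX.aemeasurable hY.aemeasurable).1 hXY,
    integral_prod _ hprod,
    integral_map hX.aemeasurable hprod.integral_prod_left.aestronglyMeasurable]

theorem IsIID.integrable_integral (h : IsIID W ν μ) {t : ℕ}
    (hX : Measurable[past W h.measurable t] X) (hG : Measurable G)
    (hint : Integrable (fun ω => G (X ω, W t ω)) μ) :
    Integrable (fun ω => ∫ w, G (X ω, w) ∂ν) μ :=
  h.map_eq t ▸ integrable_integral_of_indepFun (hX.mono ((past W _).le t) le_rfl)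
    (h.measurable t) (h.indepFun_past hX) hG hint

theorem IsIID.integral_comp (h : IsIID W ν μ) {t : ℕ}
    (hX : Measurable[past W h.measurable t] X) (hG : Measurable G)
    (hint : Integrable (fun ω => G (X ω, W t ω)) μ) :
    ∫ ω, G (X ω, W t ω) ∂μ = ∫ ω, ∫ w, G (X ω, w) ∂ν ∂μ :=
  h.map_eq t ▸ integral_comp_of_indepFun (hX.mono ((past W _).le t) le_rfl)
    (h.measurable t) (h.indepFun_past hX) hG hint

theorem IsIID.condExp_past_eq_zero (h : IsIID W ν μ) {t : ℕ}
    (hX : Measurable[past W h.measurable t] X) (hG : Measurable G)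
    (hint : Integrable (fun ω => G (X ω, W t ω)) μ) (hG0 : ∀ ω, ∫ w, G (X ω, w) ∂ν = 0) :
    μ[fun ω => G (X ω, W t ω) | past W h.measurable t] =ᵐ[μ] 0 := by
  refine (ae_eq_condExp_of_forall_setIntegral_eq ((past W h.measurable).le t) hint
    (fun s _ _ => integrableOn_zero) (fun s hs _ => ?_) aestronglyMeasurable_const).symm
  have hs0 : MeasurableSet s := (past W h.measurable).le t s hs
  have hpair : Measurable[past W h.measurable t]
      fun ω => (s.indicator (fun _ => (1 : ℝ)) ω, X ω) :=
    (measurable_const.indicator hs).prodMk hX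
  have hmul : (fun ω => s.indicator (fun _ => (1 : ℝ)) ω * G (X ω, W t ω)) =
      s.indicator fun ω => G (X ω, W t ω) := by
    ext ω
    by_cases hω : ω ∈ s <;> simp [hω]
  have hzero := h.integral_comp (G := fun p : (ℝ × α) × E => p.1.1 * G (p.1.2, p.2)) hpair
    (by fun_prop) (by simpa only [hmul] using hint.indicator hs0)
  simp only [hmul, integral_const_mul, hG0, mul_zero, integral_zero] at hzero
  rw [← integral_indicator (f := fun ω => G (X ω, W t ω)) hs0, hzero]
  exact integral_zero _ _

end IID

section ClusterPoints

variable {X ι β : Type*} [TopologicalSpace X] [CompleteLinearOrder β] [TopologicalSpace β]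
  [OrderTopology β] {s : Set X} {f : X → β} {F : Filter ι} {x : ι → X} {l : β}

theorem limsup_comp_le_of_isCompact (hs : IsCompact s) (hf : ContinuousOn f s)
    (hx : ∀ᶠ i in F, x i ∈ s)
    (h : ∀ G : Ultrafilter ι, ↑G ≤ F → ∀ a ∈ s, Tendsto x G (𝓝 a) → f a ≤ l) :
    limsup (fun i => f (x i)) F ≤ l := by
  refine (limsup_le_iff (by isBoundedDefault) (by isBoundedDefault)).2 fun y hy =>
    by_contra fun hcon => ?_
  have hfreq : ∃ᶠ i in F, y ≤ f (x i) := by simpa only [not_eventually, not_lt] using hcon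
  have : (F ⊓ 𝓟 {i | y ≤ f (x i)}).NeBot := frequently_mem_iff_neBot.1 hfreq
  let G := Ultrafilter.of (F ⊓ 𝓟 {i | y ≤ f (x i)})
  have hG : ↑G ≤ F := (Ultrafilter.of_le (F ⊓ 𝓟 {i | y ≤ f (x i)})).trans inf_le_left
  have hGy : ∀ᶠ i in G, y ≤ f (x i) :=
    le_principal_iff.1 ((Ultrafilter.of_le _).trans inf_le_right)
  obtain ⟨a, ha, hxa⟩ := hs.ultrafilter_le_nhds (G.map x) (le_principal_iff.2 (hG hx))
  have hfa : Tendsto (fun i => f (x i)) G (𝓝 (f a)) :=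
    (hf a ha).tendsto.comp (tendsto_nhdsWithin_iff.2 ⟨hxa, hG hx⟩)
  exact hy.not_ge ((ge_of_tendsto hfa hGy).trans (h G hG a ha hxa))

theorem le_liminf_comp_of_isCompact (hs : IsCompact s) (hf : ContinuousOn f s)
    (hx : ∀ᶠ i in F, x i ∈ s)
    (h : ∀ G : Ultrafilter ι, ↑G ≤ F → ∀ a ∈ s, Tendsto x G (𝓝 a) → l ≤ f a) :
    l ≤ liminf (fun i => f (x i)) F :=
  limsup_comp_le_of_isCompact (β := βᵒᵈ) hs hf hx h

end ClusterPoints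

section Utility

variable {K : ℕ} {U : (Fin K → ℝ) → EReal} {A : ℝ}

/-- The hypograph of the utility function, restricted to real ordinates. -/
def hypograph (U : (Fin K → ℝ) → EReal) : Set ((Fin K → ℝ) × ℝ) :=
  {p | p ∈ {p : (Fin K → ℝ) × ℝ | 0 ≤ p.1} ∧ (p.2 : EReal) ≤ U p.1}

theorem isClosed_hypograph (hU : ContinuousOn U (Set.Ici 0)) : IsClosed (hypograph U) :=
  (isClosed_le continuous_const continuous_fst).isClosed_le
    (continuous_coe_real_ereal.comp continuous_snd).continuousOn
    (hU.comp continuous_fst.continuousOn fun _ hp => hp)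

theorem convex_hypograph (hU : ConcaveOnOrthant U) : Convex ℝ (hypograph U) := by
  rintro ⟨x, s⟩ ⟨hx, hs⟩ ⟨y, t⟩ ⟨hy, ht⟩ a b ha hb hab
  have hx0 : (0 : Fin K → ℝ) ≤ x := hx
  have hy0 : (0 : Fin K → ℝ) ≤ y := hy
  have hxy : (0 : Fin K → ℝ) ≤ a • x + b • y := by positivity
  refine ⟨hxy, ?_⟩
  refine le_trans ?_ (hU x y hx hy a b ha hb hab)
  simp only [Prod.smul_mk, Prod.mk_add_mk, smul_eq_mul, EReal.coe_add, EReal.coe_mul]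
  exact add_le_add (mul_le_mul_of_nonneg_left hs (EReal.coe_nonneg.2 ha))
    (mul_le_mul_of_nonneg_left ht (EReal.coe_nonneg.2 hb))

theorem coe_timeAverage_le_utility (hU : ConcaveOnOrthant U) {x : ℕ → Fin K → ℝ} {u : ℕ → ℝ}
    (h : ∀ τ, (x τ, u τ) ∈ hypograph U) {n : ℕ} (hn : n ≠ 0) :
    ((timeAverage u n : ℝ) : EReal) ≤ U (timeAverage x n) := by
  have hmem := timeAverage_mem (convex_hypograph hU) h hn
  rw [timeAverage_prodMk] at hmem
  exact hmem.2

theorem box_eq_Icc (K : ℕ) (A : ℝ) : box K A = Set.Icc 0 fun _ => A := by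
  ext x
  simp [box, Set.mem_Icc, Pi.le_def, forall_and]

theorem isCompact_box (K : ℕ) (A : ℝ) : IsCompact (box K A) :=
  box_eq_Icc K A ▸ isCompact_Icc

theorem convex_box (K : ℕ) (A : ℝ) : Convex ℝ (box K A) :=
  box_eq_Icc K A ▸ convex_Icc _ _

theorem smul_mem_box {R : Fin K → ℝ} {β : ℝ} (hR : R ∈ box K A) (hβ0 : 0 ≤ β) (hβ1 : β ≤ 1) :
    β • R ∈ box K A := fun k =>
  ⟨mul_nonneg hβ0 (hR k).1, (mul_le_of_le_one_left (hR k).1 hβ1).trans (hR k).2⟩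

theorem box_subset_Ici (K : ℕ) (A : ℝ) : box K A ⊆ Set.Ici 0 := fun _ hx k => (hx k).1

theorem exists_coe_bound_on_box (hU : ContinuousOn U (Set.Ici 0))
    (hU_top : ∀ x, 0 ≤ x → U x ≠ ⊤) (hA : 0 ≤ A) : ∃ m : ℝ, ∀ x ∈ box K A, U x ≤ m := by
  obtain ⟨y, hy, hmax⟩ := (isCompact_box K A).exists_isMaxOn ⟨0, fun _ => ⟨le_rfl, hA⟩⟩
    (hU.mono (box_subset_Ici K A))
  exact ⟨(U y).toReal, fun x hx =>
    (hmax hx).trans (EReal.le_coe_toReal (hU_top y (box_subset_Ici K A hy)))⟩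

theorem liminf_utility_add_le (hU : ContinuousOn U (Set.Ici 0)) {ι : Type*} {F : Filter ι}
    {x ε : ι → Fin K → ℝ} {b : Fin K → ℝ} (hx : ∀ᶠ i in F, x i ∈ Set.Icc 0 b)
    (hε : ∀ i, 0 ≤ ε i) (hε0 : Tendsto ε F (𝓝 0)) :
    liminf (fun i => U (x i + ε i)) F ≤ liminf (fun i => U (x i)) F := by
  refine le_liminf_comp_of_isCompact isCompact_Icc (hU.mono Set.Icc_subset_Ici_self) hx
    fun G hG a ha hxa => ?_
  have hsum : Tendsto (fun i => x i + ε i) G (𝓝 a) := by simpa using hxa.add (hε0.mono_left hG)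
  have hUsum : Tendsto (fun i => U (x i + ε i)) G (𝓝 (U a)) :=
    (hU a ha.1).tendsto.comp (tendsto_nhdsWithin_iff.2
      ⟨hsum, Eventually.mono (hG hx) fun i hi => add_nonneg hi.1 (hε i)⟩)
  exact (liminf_le_liminf_of_le hG).trans_eq hUsum.liminf_eq

theorem limsup_utility_le (hU : ContinuousOn U (Set.Ici 0)) {S : Set (Fin K → ℝ)}
    (hS : IsClosed S) (hlower : ∀ z ∈ S, ∀ x, 0 ≤ x → x ≤ z → x ∈ S) (hS0 : ∀ z ∈ S, 0 ≤ z)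
    {l : EReal} (hl : ∀ x ∈ S ∩ box K A, U x ≤ l) {ι : Type*} {F : Filter ι}
    {a b ε : ι → Fin K → ℝ} (ha : ∀ᶠ i in F, a i ∈ box K A) (hb : ∀ᶠ i in F, b i ∈ S)
    (hle : ∀ᶠ i in F, a i ≤ b i + ε i) (hε0 : Tendsto ε F (𝓝 0)) :
    limsup (fun i => U (a i)) F ≤ l := by
  refine limsup_comp_le_of_isCompact (isCompact_box K A) (hU.mono (box_subset_Ici K A)) ha
    fun G hG ρ hρ haρ => hl ρ ⟨?_, hρ⟩
  have hsup : Continuous fun x : Fin K → ℝ => x ⊔ 0 :=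
    continuous_pi fun k => (continuous_apply k).max continuous_const
  have hlim : Tendsto (fun i => (a i - ε i) ⊔ 0) G (𝓝 ρ) := by
    have hlim' := (hsup.tendsto _).comp (haρ.sub (hε0.mono_left hG))
    rwa [sub_zero, sup_eq_left.2 (box_subset_Ici K A hρ)] at hlim'
  refine hS.mem_of_tendsto hlim (hG ?_)
  filter_upwards [hb, hle] with i hbi hlei
  exact hlower _ hbi _ le_sup_right (sup_le (sub_le_iff_le_add.2 hlei) (hS0 _ hbi))

theorem exists_slack (hU : ContinuousOn U (Set.Ici 0)) {S : Set (Fin K → ℝ)}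
    (hA : 0 ≤ A) (hS : Convex ℝ S) {r y : Fin K → ℝ} (hr : r ∈ S) (hr0 : ∀ k, 0 < r k)
    (hy : y ∈ S ∩ box K A) (hUy : U y ≠ ⊥) :
    ∃ x ∈ box K A, U x ≠ ⊥ ∧ ∃ z ∈ S, ∃ δ > 0, ∀ k, x k + δ < z k := by
  let x : ℝ → Fin K → ℝ := fun ε k => min ((1 - ε) * y k + ε * (r k / 2)) A
  have hx0 : x 0 = y := funext fun k => by simp [x, (hy.2 k).2]
  have hxbox : Set.MapsTo x (Set.Icc 0 1) (box K A) := fun ε hε k =>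
    ⟨le_min (add_nonneg (mul_nonneg (sub_nonneg.2 hε.2) (hy.2 k).1)
      (mul_nonneg hε.1 (half_pos (hr0 k)).le)) hA, min_le_right _ _⟩
  have hUx : ContinuousOn (U ∘ x) (Set.Icc 0 1) :=
    hU.comp (by fun_prop) fun ε hε => box_subset_Ici K A (hxbox hε)
  have hev : ∀ᶠ ε in 𝓝[>] (0 : ℝ), U (x ε) ≠ ⊥ := by
    rw [← nhdsWithin_Ioc_eq_nhdsGT one_pos]
    refine ((hUx 0 (by simp)).mono Set.Ioc_subset_Icc_self).tendsto.eventually_ne ?_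
    simpa only [Function.comp_apply, hx0] using hUy
  obtain ⟨ε, hεU, hε⟩ := (hev.and (Ioc_mem_nhdsGT one_pos)).exists
  refine ⟨x ε, hxbox ⟨hε.1.le, hε.2⟩, hεU, (1 - ε) • y + ε • r,
    hS hy.1 hr (sub_nonneg.2 hε.2) hε.1.le (sub_add_cancel 1 ε),
    Pi.exists_forall_pos_add_lt fun k => (min_le_left _ _).trans_lt ?_⟩
  have hhalf := mul_lt_mul_of_pos_left (half_lt_self (hr0 k)) hε.1
  simpa using hhalf

end Utility

theorem sq_max_sub_add_le {q r a : ℝ} (hq : 0 ≤ q) (hr : 0 ≤ r) (ha : 0 ≤ a) :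
    (max 0 (q - r) + a) ^ 2 ≤ q ^ 2 + (a ^ 2 + r ^ 2) + 2 * (q * (a - r)) := by
  rcases max_cases 0 (q - r) with ⟨hmax, -⟩ | ⟨hmax, -⟩ <;> rw [hmax]
  · nlinarith [sq_nonneg (q - r), mul_nonneg hq ha]
  · nlinarith [mul_nonneg hr ha]

theorem mul_sub_mul_mul_le {S T a c : ℝ} (hS : 0 ≤ S) (hT : 0 ≤ T) (hST : S ≤ T ^ 2)
    (ha : 0 < a) (hc : 0 ≤ c) : c * S - a * (S * T) ≤ c * (c / a) ^ 2 := by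
  rcases le_total (c / a) T with h | h
  · have hcT : S * c ≤ S * (T * a) := mul_le_mul_of_nonneg_left ((div_le_iff₀ ha).1 h) hS
    have : 0 ≤ c * (c / a) ^ 2 := by positivity
    linarith
  · have hcS := mul_le_mul_of_nonneg_left (hST.trans (pow_le_pow_left₀ hT h 2)) hc
    have : 0 ≤ a * (S * T) := by positivity
    linarith

theorem integrable_of_integrable_pow_four {α : Type*} [MeasurableSpace α] {μ : Measure α}
    [IsFiniteMeasure μ] {f : α → ℝ} (hf : AEStronglyMeasurable f μ)
    (h : Integrable (fun x => f x ^ 4) μ) : Integrable f μ := by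
  have hsq : MemLp (fun x => f x ^ 2) 2 μ :=
    (memLp_two_iff_integrable_sq (hf.pow 2)).2 (by
      simpa only [Pi.pow_apply, ← pow_mul] using h)
  exact ((memLp_two_iff_integrable_sq hf).2 (hsq.integrable one_le_two)).integrable one_le_two

/-- A network of `K` virtual queues driven by i.i.d. slots with values in `E`: the arrivals solve
the drift-plus-penalty problem `max V U(x) - ∑ₖ xₖ qₖ` over a box, and the service rates are
max-weight, i.e. their mean maximizes `∑ₖ qₖ Rₖ` over a closed, convex, downward closed region. -/
structure QueueSystem (K : ℕ) (E : Type*) [MeasurableSpace E] where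
  law : Measure E
  isProbabilityMeasure_law : IsProbabilityMeasure law
  rate : (Fin K → ℝ) → E → Fin K → ℝ
  arrival : (Fin K → ℝ) → Fin K → ℝ
  rateBound : E → Fin K → ℝ
  region : Set (Fin K → ℝ)
  U : (Fin K → ℝ) → EReal
  V : ℝ
  A : ℝ
  measurable_rate : Measurable fun p : (Fin K → ℝ) × E => rate p.1 p.2
  measurable_arrival : Measurable arrival
  measurable_rateBound : Measurable rateBound
  rate_nonneg : ∀ q w k, 0 ≤ rate q w k
  rate_le : ∀ q w k, rate q w k ≤ rateBound w k
  integrable_rateBound_pow_four : ∀ k, Integrable (fun w => rateBound w k ^ 4) law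
  V_pos : 0 < V
  A_pos : 0 < A
  U_ne_top : ∀ x, 0 ≤ x → U x ≠ ⊤
  continuousOn_U : ContinuousOn U (Set.Ici 0)
  concaveOn_U : ConcaveOnOrthant U
  monotoneOn_U : MonotoneOn U (Set.Ici 0)
  isClosed_region : IsClosed region
  convex_region : Convex ℝ region
  region_nonneg : ∀ z ∈ region, 0 ≤ z
  region_lower : ∀ z ∈ region, ∀ x, 0 ≤ x → x ≤ z → x ∈ region
  arrival_mem : ∀ q, arrival q ∈ box K A
  arrival_optimal : ∀ q, 0 ≤ q → ∀ x ∈ box K A,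
    (V : EReal) * U x - ((∑ k, x k * q k : ℝ) : EReal) ≤
      (V : EReal) * U (arrival q) - ((∑ k, arrival q k * q k : ℝ) : EReal)
  max_weight : ∀ q, 0 ≤ q → ∀ R ∈ region,
    ∑ k, q k * R k ≤ ∑ k, q k * ∫ w, rate q w k ∂law
  mean_rate_mem : ∀ q, (fun k => ∫ w, rate q w k ∂law) ∈ region

/-- The quadratic Lyapunov function. -/
noncomputable def lyapunov {K : ℕ} (q : Fin K → ℝ) : ℝ := ∑ k, q k ^ 2

section Lyapunov

variable {K : ℕ}

theorem lyapunov_nonneg (q : Fin K → ℝ) : 0 ≤ lyapunov q :=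
  Finset.sum_nonneg fun _ _ => sq_nonneg _

theorem continuous_lyapunov : Continuous (lyapunov (K := K)) := by
  unfold lyapunov
  fun_prop

theorem sq_le_lyapunov (q : Fin K → ℝ) (k : Fin K) : q k ^ 2 ≤ lyapunov q :=
  Finset.single_le_sum (f := fun k => q k ^ 2) (fun _ _ => sq_nonneg _) (Finset.mem_univ k)

end Lyapunov

namespace QueueSystem

variable {K : ℕ} {E : Type*} [MeasurableSpace E] (N : QueueSystem K E)

instance : IsProbabilityMeasure N.law := N.isProbabilityMeasure_law

/-- One step of the queue recursion. -/
noncomputable def step (q : Fin K → ℝ) (w : E) : Fin K → ℝ :=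
  fun k => max 0 (q k - N.rate q w k) + N.arrival q k

/-- The virtual queues along a sequence of slots. -/
noncomputable def queue (q₀ : Fin K → ℝ) (w : ℕ → E) : ℕ → Fin K → ℝ
  | 0 => q₀
  | t + 1 => N.step (queue q₀ w t) (w t)

/-- The mean service rate for given queues. -/
noncomputable def meanRate (q : Fin K → ℝ) (k : Fin K) : ℝ := ∫ w, N.rate q w k ∂N.law

/-- The second order term in the drift of the Lyapunov function; its mean is `2κ`. -/
noncomputable def incr (w : E) : ℝ := ∑ k, (N.A ^ 2 + N.rateBound w k ^ 2)

/-- Half the conditional mean of the first order term in the drift of the Lyapunov function. -/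
noncomputable def meanDrift (q : Fin K → ℝ) : ℝ := ∑ k, q k * (N.arrival q k - N.meanRate q k)

/-- Half the centred part of the first order term in the drift of the Lyapunov function. -/
noncomputable def noise (q : Fin K → ℝ) (w : E) : ℝ := ∑ k, q k * (N.meanRate q k - N.rate q w k)

/-- The factor multiplying the Lyapunov function in the bound on the squared noise. -/
noncomputable def noiseBound (w : E) : ℝ :=
  ∑ k, ((∫ w, N.rateBound w k ∂N.law) ^ 2 + N.rateBound w k ^ 2)

/-- The utility of the arrivals as a real number (`0` if the utility is infinite). -/
noncomputable def util (q : Fin K → ℝ) : ℝ := (N.U (N.arrival q)).toReal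

/-- Negative drift, up to a constant, of the squared Lyapunov function. -/
def QuarticDrift (C : ℝ) : Prop :=
  ∀ q, 0 ≤ q → ∫ w, lyapunov (N.step q w) ^ 2 ∂N.law ≤ lyapunov q ^ 2 + C - lyapunov q

section Measurability

theorem measurable_rate_apply (k : Fin K) :
    Measurable fun p : (Fin K → ℝ) × E => N.rate p.1 p.2 k :=
  (measurable_pi_apply k).comp N.measurable_rate

theorem measurable_rateBound_apply (k : Fin K) : Measurable fun w => N.rateBound w k :=
  (measurable_pi_apply k).comp N.measurable_rateBound

theorem measurable_step : Measurable fun p : (Fin K → ℝ) × E => N.step p.1 p.2 :=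
  measurable_pi_lambda _ fun k =>
    (measurable_const.max (((measurable_pi_apply k).comp measurable_fst).sub
      (N.measurable_rate_apply k))).add
      ((measurable_pi_apply k).comp (N.measurable_arrival.comp measurable_fst))

theorem measurable_meanRate : Measurable N.meanRate :=
  measurable_pi_lambda _ fun k =>
    (N.measurable_rate_apply k).stronglyMeasurable.integral_prod_right'.measurable

theorem measurable_noise : Measurable fun p : (Fin K → ℝ) × E => N.noise p.1 p.2 := by
  have hrate := N.measurable_rate_apply
  have hmean : ∀ k, Measurable fun q => N.meanRate q k := fun k =>
    (measurable_pi_apply k).comp N.measurable_meanRate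
  unfold noise
  fun_prop

theorem measurable_incr : Measurable N.incr := by
  have := N.measurable_rateBound_apply
  unfold incr
  fun_prop

theorem measurable_noiseBound : Measurable N.noiseBound := by
  have := N.measurable_rateBound_apply
  unfold noiseBound
  fun_prop

theorem measurable_util : Measurable N.util := by
  have hU : Continuous ((Set.Ici (0 : Fin K → ℝ)).domRestrict N.U) :=
    continuousOn_iff_continuous_domRestrict.1 N.continuousOn_U
  have harrival : Measurable fun q => (⟨N.arrival q, box_subset_Ici K N.A (N.arrival_mem q)⟩ :
      Set.Ici (0 : Fin K → ℝ)) := N.measurable_arrival.subtype_mk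
  exact (hU.measurable.comp harrival).ereal_toReal

end Measurability

section Moments

theorem memLp_rateBound_sq (k : Fin K) : MemLp (fun w => N.rateBound w k ^ 2) 2 N.law := by
  refine (memLp_two_iff_integrable_sq
    ((N.measurable_rateBound_apply k).pow_const 2).aestronglyMeasurable).2 ?_
  simpa only [← pow_mul] using N.integrable_rateBound_pow_four k

theorem integrable_rateBound_sq (k : Fin K) : Integrable (fun w => N.rateBound w k ^ 2) N.law :=
  (N.memLp_rateBound_sq k).integrable one_le_two

theorem integrable_rateBound (k : Fin K) : Integrable (fun w => N.rateBound w k) N.law :=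
  integrable_of_integrable_pow_four (N.measurable_rateBound_apply k).aestronglyMeasurable
    (N.integrable_rateBound_pow_four k)

theorem memLp_incr : MemLp N.incr 2 N.law :=
  memLp_finsetSum _ fun k _ => (memLp_const (N.A ^ 2)).add (N.memLp_rateBound_sq k)

theorem integrable_incr : Integrable N.incr N.law := N.memLp_incr.integrable one_le_two

theorem integrable_noiseBound : Integrable N.noiseBound N.law :=
  integrable_finsetSum _ fun k _ => (integrable_const _).add (N.integrable_rateBound_sq k)

theorem incr_nonneg (w : E) : 0 ≤ N.incr w := by
  unfold incr
  positivity

theorem integrable_rate (q : Fin K → ℝ) (k : Fin K) : Integrable (fun w => N.rate q w k) N.law :=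
  (N.integrable_rateBound k).mono'
    ((N.measurable_rate_apply k).comp measurable_prodMk_left).aestronglyMeasurable
    (ae_of_all _ fun w => by
      rw [Real.norm_of_nonneg (N.rate_nonneg q w k)]
      exact N.rate_le q w k)

theorem meanRate_nonneg (q : Fin K → ℝ) (k : Fin K) : 0 ≤ N.meanRate q k :=
  integral_nonneg fun w => N.rate_nonneg q w k

theorem meanRate_le (q : Fin K → ℝ) (k : Fin K) :
    N.meanRate q k ≤ ∫ w, N.rateBound w k ∂N.law :=
  integral_mono (N.integrable_rate q k) (N.integrable_rateBound k) fun w => N.rate_le q w k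

theorem integrable_noise_summand (q : Fin K → ℝ) (k : Fin K) :
    Integrable (fun w => q k * (N.meanRate q k - N.rate q w k)) N.law :=
  ((integrable_const _).sub (N.integrable_rate q k)).const_mul _

theorem integrable_noise (q : Fin K → ℝ) : Integrable (N.noise q) N.law :=
  integrable_finsetSum _ fun k _ => N.integrable_noise_summand q k

theorem integral_noise (q : Fin K → ℝ) : ∫ w, N.noise q w ∂N.law = 0 := by
  unfold noise
  rw [integral_finsetSum _ fun k _ => N.integrable_noise_summand q k]
  refine Finset.sum_eq_zero fun k _ => ?_
  rw [integral_const_mul, integral_sub (integrable_const _) (N.integrable_rate q k)]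
  simp [meanRate]

theorem noise_sq_le (q : Fin K → ℝ) (w : E) : N.noise q w ^ 2 ≤ lyapunov q * N.noiseBound w := by
  refine (Finset.sum_mul_sq_le_sq_mul_sq _ _ _).trans
    (mul_le_mul_of_nonneg_left (Finset.sum_le_sum fun k _ => ?_) (lyapunov_nonneg q))
  have hmean0 := N.meanRate_nonneg q k
  have hrate0 := N.rate_nonneg q w k
  have hmean := pow_le_pow_left₀ hmean0 (N.meanRate_le q k) 2
  have hrate := pow_le_pow_left₀ hrate0 (N.rate_le q w k) 2
  nlinarith [mul_nonneg hmean0 hrate0]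

end Moments

section Drift

theorem step_nonneg (q : Fin K → ℝ) (w : E) : 0 ≤ N.step q w := fun k =>
  add_nonneg (le_max_left _ _) (N.arrival_mem q k).1

theorem step_le {q : Fin K → ℝ} (hq : 0 ≤ q) (w : E) (k : Fin K) : N.step q w k ≤ q k + N.A :=
  add_le_add (max_le (hq k) (sub_le_self _ (N.rate_nonneg q w k))) (N.arrival_mem q k).2

theorem meanDrift_add_noise (q : Fin K → ℝ) (w : E) :
    N.meanDrift q + N.noise q w = ∑ k, q k * (N.arrival q k - N.rate q w k) := by
  simp only [meanDrift, noise, ← Finset.sum_add_distrib, ← mul_add, sub_add_sub_cancel]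

theorem arrival_sq_add_rate_sq_le (q : Fin K → ℝ) (w : E) (k : Fin K) :
    N.arrival q k ^ 2 + N.rate q w k ^ 2 ≤ N.A ^ 2 + N.rateBound w k ^ 2 :=
  add_le_add (pow_le_pow_left₀ (N.arrival_mem q k).1 (N.arrival_mem q k).2 2)
    (pow_le_pow_left₀ (N.rate_nonneg q w k) (N.rate_le q w k) 2)

theorem lyapunov_step_le {q : Fin K → ℝ} (hq : 0 ≤ q) (w : E) :
    lyapunov (N.step q w) ≤ lyapunov q + N.incr w + 2 * (N.meanDrift q + N.noise q w) := by
  rw [meanDrift_add_noise, lyapunov, lyapunov, incr, Finset.mul_sum, ← Finset.sum_add_distrib,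
    ← Finset.sum_add_distrib]
  refine Finset.sum_le_sum fun k _ =>
    (sq_max_sub_add_le (hq k) (N.rate_nonneg q w k) (N.arrival_mem q k).1).trans ?_
  gcongr ?_ + _
  exact add_le_add_right (N.arrival_sq_add_rate_sq_le q w k) _

theorem sq_meanDrift_add_noise_le (q : Fin K → ℝ) (w : E) :
    (N.meanDrift q + N.noise q w) ^ 2 ≤ lyapunov q * N.incr w := by
  rw [meanDrift_add_noise]
  refine (Finset.sum_mul_sq_le_sq_mul_sq _ _ _).trans
    (mul_le_mul_of_nonneg_left (Finset.sum_le_sum fun k _ => ?_) (lyapunov_nonneg q))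
  have hprod := mul_nonneg (N.arrival_mem q k).1 (N.rate_nonneg q w k)
  linarith [N.arrival_sq_add_rate_sq_le q w k, sub_sq (N.arrival q k) (N.rate q w k)]

variable {q x R : Fin K → ℝ}

theorem coe_toReal_U (hx : x ∈ box K N.A) (hUx : N.U x ≠ ⊥) : ((N.U x).toReal : EReal) = N.U x :=
  EReal.coe_toReal (N.U_ne_top x (box_subset_Ici K N.A hx)) hUx

theorem coe_util (hq : 0 ≤ q) (hx : x ∈ box K N.A) (hUx : N.U x ≠ ⊥) :
    (N.util q : EReal) = N.U (N.arrival q) := by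
  refine N.coe_toReal_U (N.arrival_mem q) fun hbot => ?_
  have h := N.arrival_optimal q hq x hx
  rw [hbot, EReal.coe_mul_bot_of_pos N.V_pos, EReal.bot_sub, ← N.coe_toReal_U hx hUx,
    ← EReal.coe_mul, ← EReal.coe_sub, le_bot_iff] at h
  exact EReal.coe_ne_bot _ h

theorem arrival_util_mem_hypograph (hq : 0 ≤ q) (hx : x ∈ box K N.A) (hUx : N.U x ≠ ⊥) :
    (N.arrival q, N.util q) ∈ hypograph N.U :=
  ⟨box_subset_Ici K N.A (N.arrival_mem q), (N.coe_util hq hx hUx).le⟩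

theorem sum_mul_arrival_le (hq : 0 ≤ q) (hx : x ∈ box K N.A) (hUx : N.U x ≠ ⊥) :
    ∑ k, q k * N.arrival q k ≤
      ∑ k, q k * x k + N.V * N.util q - N.V * (N.U x).toReal := by
  have h := N.arrival_optimal q hq x hx
  rw [← N.coe_util hq hx hUx, ← N.coe_toReal_U hx hUx, ← EReal.coe_mul, ← EReal.coe_sub,
    ← EReal.coe_mul, ← EReal.coe_sub, EReal.coe_le_coe_iff] at h
  simp only [mul_comm (q _)]
  linarith

theorem util_le {m : ℝ} (hm : ∀ x ∈ box K N.A, N.U x ≤ m) (hq : 0 ≤ q) (hx : x ∈ box K N.A)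
    (hUx : N.U x ≠ ⊥) : N.util q ≤ m := by
  rw [← EReal.coe_le_coe_iff, N.coe_util hq hx hUx]
  exact hm _ (N.arrival_mem q)

theorem abs_util_le {m : ℝ} (hm : ∀ x ∈ box K N.A, N.U x ≤ m) (hq : 0 ≤ q)
    (hx : x ∈ box K N.A) (hUx : N.U x ≠ ⊥) :
    |N.util q| ≤ |m| + |(N.U x).toReal| + (∑ k, q k * x k) / N.V := by
  have hqx : 0 ≤ ∑ k, q k * x k := Finset.sum_nonneg fun k _ => mul_nonneg (hq k) (hx k).1
  have harrival : 0 ≤ ∑ k, q k * N.arrival q k :=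
    Finset.sum_nonneg fun k _ => mul_nonneg (hq k) (N.arrival_mem q k).1
  have hlower : (N.U x).toReal - (∑ k, q k * x k) / N.V ≤ N.util q := by
    rw [sub_le_iff_le_add, ← sub_le_iff_le_add', le_div_iff₀ N.V_pos]
    linarith [N.sum_mul_arrival_le hq hx hUx]
  have := div_nonneg hqx N.V_pos.le
  rw [abs_le]
  constructor
  · linarith [neg_abs_le (N.U x).toReal, abs_nonneg m]
  · linarith [N.util_le hm hq hx hUx, le_abs_self m, abs_nonneg (N.U x).toReal]

theorem meanDrift_le (hq : 0 ≤ q) (hx : x ∈ box K N.A) (hUx : N.U x ≠ ⊥) (hR : R ∈ N.region) :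
    N.meanDrift q ≤
      ∑ k, q k * (x k - R k) + N.V * N.util q - N.V * (N.U x).toReal := by
  have harrival := N.sum_mul_arrival_le hq hx hUx
  have hrate : ∑ k, q k * R k ≤ ∑ k, q k * N.meanRate q k := N.max_weight q hq R hR
  simp only [meanDrift, mul_sub, Finset.sum_sub_distrib]
  linarith

theorem half_lyapunov_step_sub_le (hq : 0 ≤ q) (hx : x ∈ box K N.A) (hUx : N.U x ≠ ⊥)
    (hR : R ∈ N.region) (w : E) :
    1 / 2 * lyapunov (N.step q w) - 1 / 2 * lyapunov q ≤ 1 / 2 * N.incr w + N.noise q w +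
      (∑ k, q k * (x k - R k) + N.V * N.util q - N.V * (N.U x).toReal) := by
  linarith [N.lyapunov_step_le hq w, N.meanDrift_le hq hx hUx hR]

theorem meanDrift_le_of_slack {m δ : ℝ} (hm : ∀ x ∈ box K N.A, N.U x ≤ m) (hq : 0 ≤ q)
    (hx : x ∈ box K N.A) (hUx : N.U x ≠ ⊥) (hR : R ∈ N.region) (hslack : ∀ k, x k + δ ≤ R k) :
    N.meanDrift q ≤ N.V * (m - (N.U x).toReal) - δ * ∑ k, q k := by
  have hgap : ∑ k, q k * (x k - R k) ≤ -(δ * ∑ k, q k) := by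
    rw [Finset.mul_sum, ← Finset.sum_neg_distrib]
    refine Finset.sum_le_sum fun k _ => ?_
    have := mul_le_mul_of_nonneg_left (hslack k) (hq k)
    linarith
  have := mul_le_mul_of_nonneg_left (N.util_le hm hq hx hUx) N.V_pos.le
  linarith [N.meanDrift_le hq hx hUx hR]

end Drift

section QuarticDrift

variable {q x z : Fin K → ℝ}

theorem sq_lyapunov_step_le (hq : 0 ≤ q) (w : E) :
    lyapunov (N.step q w) ^ 2 ≤ (lyapunov q ^ 2 + 4 * lyapunov q * N.meanDrift q) +
      10 * lyapunov q * N.incr w + 4 * lyapunov q * N.noise q w + 2 * N.incr w ^ 2 := by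
  have hstep := pow_le_pow_left₀ (lyapunov_nonneg _) (N.lyapunov_step_le hq w) 2
  have hcs := N.sq_meanDrift_add_noise_le q w
  have hamgm := sq_nonneg (N.incr w - 2 * (N.meanDrift q + N.noise q w))
  linarith

theorem integral_sq_lyapunov_step_le (hq : 0 ≤ q) :
    ∫ w, lyapunov (N.step q w) ^ 2 ∂N.law ≤ lyapunov q ^ 2 + 4 * lyapunov q * N.meanDrift q +
      10 * lyapunov q * ∫ w, N.incr w ∂N.law + 2 * ∫ w, N.incr w ^ 2 ∂N.law := by
  have hconst := integrable_const (μ := N.law) (lyapunov q ^ 2 + 4 * lyapunov q * N.meanDrift q)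
  have hincr := N.integrable_incr.const_mul (10 * lyapunov q)
  have hnoise := (N.integrable_noise q).const_mul (4 * lyapunov q)
  have hsq := N.memLp_incr.integrable_sq.const_mul 2
  refine (integral_mono_of_nonneg (ae_of_all _ fun w => sq_nonneg _)
    (((hconst.add hincr).add hnoise).add hsq)
    (ae_of_all _ fun w => N.sq_lyapunov_step_le hq w)).trans_eq ?_
  rw [integral_add' ((hconst.add hincr).add hnoise) hsq, integral_add' (hconst.add hincr) hnoise,
    integral_add' hconst hincr]
  simp only [integral_const_mul, integral_noise, integral_const, probReal_univ, one_smul,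
    mul_zero, add_zero]

theorem exists_quarticDrift_of_slack {δ : ℝ} (hx : x ∈ box K N.A) (hUx : N.U x ≠ ⊥) (hδ : 0 < δ)
    (hz : z ∈ N.region) (hslack : ∀ k, x k + δ ≤ z k) : ∃ C, 0 ≤ C ∧ N.QuarticDrift C := by
  obtain ⟨m, hm⟩ := exists_coe_bound_on_box N.continuousOn_U N.U_ne_top N.A_pos.le
  set b := ∫ w, N.incr w ∂N.law
  set c₀ := N.V * (m - (N.U x).toReal)
  have hb : 0 ≤ b := integral_nonneg N.incr_nonneg
  have hc₀ : 0 ≤ c₀ := by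
    have hxm := hm x hx
    rw [← N.coe_toReal_U hx hUx, EReal.coe_le_coe_iff] at hxm
    exact mul_nonneg N.V_pos.le (sub_nonneg.2 hxm)
  set c := 10 * b + 4 * c₀ + 1 with hc
  refine ⟨2 * ∫ w, N.incr w ^ 2 ∂N.law + c * (c / (4 * δ)) ^ 2, by positivity, fun q hq => ?_⟩
  have hL := lyapunov_nonneg q
  have hdrift := mul_le_mul_of_nonneg_left (N.meanDrift_le_of_slack hm hq hx hUx hz hslack)
    (mul_nonneg zero_le_four hL)
  have hquad : c * lyapunov q - 4 * δ * (lyapunov q * ∑ k, q k) ≤ c * (c / (4 * δ)) ^ 2 :=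
    mul_sub_mul_mul_le hL (Finset.sum_nonneg fun k _ => hq k)
      (Finset.sum_sq_le_sq_sum_of_nonneg fun k _ => hq k) (by positivity) (by positivity)
  rw [hc, add_mul, add_mul, one_mul, ← hc] at hquad
  linarith [N.integral_sq_lyapunov_step_le hq]

theorem exists_quarticDrift {r y : Fin K → ℝ} (hr : r ∈ N.region) (hr0 : ∀ k, 0 < r k)
    (hy : y ∈ N.region ∩ box K N.A) (hUy : N.U y ≠ ⊥) : ∃ C, 0 ≤ C ∧ N.QuarticDrift C := by
  obtain ⟨x, hx, hUx, z, hz, δ, hδ, hslack⟩ :=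
    exists_slack N.continuousOn_U N.A_pos.le N.convex_region hr hr0 hy hUy
  exact N.exists_quarticDrift_of_slack hx hUx hδ hz fun k => (hslack k).le

end QuarticDrift

end QueueSystem

namespace QueueSystem

variable {K : ℕ} {E : Type*} [MeasurableSpace E] (N : QueueSystem K E)

section SamplePaths

variable {q₀ : Fin K → ℝ}

theorem queue_nonneg (hq₀ : 0 ≤ q₀) (w : ℕ → E) : ∀ t, 0 ≤ N.queue q₀ w t
  | 0 => hq₀
  | _ + 1 => N.step_nonneg _ _

theorem queue_le (hq₀ : 0 ≤ q₀) (w : ℕ → E) (t : ℕ) (k : Fin K) :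
    N.queue q₀ w t k ≤ q₀ k + t * N.A := by
  induction t with
  | zero => simp [queue]
  | succ t ih =>
    have := N.step_le (N.queue_nonneg hq₀ w t) (w t) k
    rw [queue]
    push_cast
    linarith

theorem exists_bound_continuous_queue (hq₀ : 0 ≤ q₀) {f : (Fin K → ℝ) → ℝ} (hf : Continuous f)
    (t : ℕ) : ∃ c, ∀ w : ℕ → E, ‖f (N.queue q₀ w t)‖ ≤ c := by
  obtain ⟨c, hc⟩ := (isCompact_Icc (a := (0 : Fin K → ℝ))
    (b := fun k => q₀ k + t * N.A)).exists_bound_of_continuousOn hf.continuousOn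
  exact ⟨c, fun w => hc _ ⟨N.queue_nonneg hq₀ w t, N.queue_le hq₀ w t⟩⟩

theorem arrival_sub_rate_le (w : ℕ → E) (t : ℕ) :
    N.arrival (N.queue q₀ w t) - N.rate (N.queue q₀ w t) (w t) ≤
      N.queue q₀ w (t + 1) - N.queue q₀ w t := fun k => by
  have hmax := le_max_right 0 (N.queue q₀ w t k - N.rate (N.queue q₀ w t) (w t) k)
  simp only [queue, step, Pi.sub_apply]
  linarith

theorem timeAverage_arrival_le (hq₀ : 0 ≤ q₀) (w : ℕ → E) (n : ℕ) :
    timeAverage (fun τ => N.arrival (N.queue q₀ w τ)) n ≤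
      timeAverage (fun τ => N.rate (N.queue q₀ w τ) (w τ)) n +
        (1 / (n : ℝ)) • N.queue q₀ w (n + 1) :=
  timeAverage_le_timeAverage_add_smul (N.queue_nonneg hq₀ w) (N.arrival_sub_rate_le w) n

theorem le_timeAverage_util (hq₀ : 0 ≤ q₀) {x : Fin K → ℝ} (hx : x ∈ N.region ∩ box K N.A)
    (hUx : N.U x ≠ ⊥) (w : ℕ → E) {n : ℕ} (hn : n ≠ 0) :
    (N.U x).toReal - (1 / 2 * timeAverage (fun τ => N.incr (w τ)) n +
        timeAverage (fun τ => N.noise (N.queue q₀ w τ) (w τ)) n +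
        1 / (n : ℝ) * (1 / 2 * lyapunov (N.queue q₀ w 1))) / N.V ≤
      timeAverage (fun τ => N.util (N.queue q₀ w τ)) n := by
  have hslot : ∀ τ, 1 / 2 * lyapunov (N.queue q₀ w (τ + 1)) - 1 / 2 * lyapunov (N.queue q₀ w τ) ≤
      1 / 2 * N.incr (w τ) + N.noise (N.queue q₀ w τ) (w τ) +
        (N.V * N.util (N.queue q₀ w τ) - N.V * (N.U x).toReal) := fun τ => by
    simpa [queue] using N.half_lyapunov_step_sub_le (N.queue_nonneg hq₀ w τ) hx.2 hUx hx.1 (w τ)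
  have havg := neg_smul_le_timeAverage_of_sub_le
    (fun τ => mul_nonneg one_half_pos.le (lyapunov_nonneg (N.queue q₀ w τ))) hslot n
  rw [timeAverage_add, timeAverage_add, timeAverage_sub, timeAverage_mul_left,
    timeAverage_mul_left, timeAverage_const _ hn, smul_eq_mul] at havg
  rw [sub_le_iff_le_add, ← sub_le_iff_le_add', le_div_iff₀ N.V_pos]
  linarith

end SamplePaths

section Trajectories

variable {Ω : Type*} {m0 : MeasurableSpace Ω} {μ : Measure Ω} {W : ℕ → Ω → E} {q₀ : Fin K → ℝ}

theorem measurable_queue_past (hW : ∀ t, Measurable (W t)) (t : ℕ) :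
    Measurable[past W hW t] fun ω => N.queue q₀ (W · ω) t := by
  induction t with
  | zero => exact measurable_const
  | succ t ih =>
    exact N.measurable_step.comp ((ih.mono ((past W hW).mono t.le_succ) le_rfl).prodMk
      (measurable_past_succ hW t))

theorem measurable_queue (hW : ∀ t, Measurable (W t)) (t : ℕ) :
    Measurable fun ω => N.queue q₀ (W · ω) t :=
  (N.measurable_queue_past hW t).mono ((past W hW).le t) le_rfl

theorem integrable_lyapunov_queue_mul_noiseBound (h : IsIID W N.law μ) (hq₀ : 0 ≤ q₀) (t : ℕ) :
    Integrable (fun ω => lyapunov (N.queue q₀ (W · ω) t) * N.noiseBound (W t ω)) μ := by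
  obtain ⟨b, hb⟩ := N.exists_bound_continuous_queue hq₀ continuous_lyapunov t
  exact (h.integrable_comp N.integrable_noiseBound t).bdd_mul
    (continuous_lyapunov.measurable.comp (N.measurable_queue h.measurable t)).aestronglyMeasurable
    (ae_of_all _ fun ω => hb _)

theorem memLp_noise_queue (h : IsIID W N.law μ) (hq₀ : 0 ≤ q₀) (t : ℕ) :
    MemLp (fun ω => N.noise (N.queue q₀ (W · ω) t) (W t ω)) 2 μ := by
  have hmeas : Measurable fun ω => N.noise (N.queue q₀ (W · ω) t) (W t ω) :=
    N.measurable_noise.comp ((N.measurable_queue h.measurable t).prodMk (h.measurable t))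
  refine (memLp_two_iff_integrable_sq hmeas.aestronglyMeasurable).2
    ((N.integrable_lyapunov_queue_mul_noiseBound h hq₀ t).mono'
      (hmeas.pow_const 2).aestronglyMeasurable (ae_of_all _ fun ω => ?_))
  rw [Real.norm_of_nonneg (sq_nonneg _)]
  exact N.noise_sq_le _ _

theorem ae_eventually_timeAverage_rate_mem (h : IsIID W N.law μ) :
    ∀ᵐ ω ∂μ, ∀ᶠ n in atTop, timeAverage (fun τ => N.rate (N.queue q₀ (W · ω) τ) (W τ ω)) n ∈
      Set.Icc 0 fun k => ∫ w, N.rateBound w k ∂N.law + 1 := by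
  filter_upwards [ae_all_iff.2 fun k => h.ae_tendsto_timeAverage (N.measurable_rateBound_apply k)
    (N.integrable_rateBound k)] with ω hω
  filter_upwards [eventually_all.2 fun k => (hω k).eventually_le_const (lt_add_one _)] with n hn
  refine ⟨smul_nonneg (by positivity) (Finset.sum_nonneg fun τ _ k => N.rate_nonneg _ _ k),
    fun k => ?_⟩
  rw [timeAverage_apply]
  exact (timeAverage_mono (fun τ => N.rate_le _ _ k) n).trans (hn k)

variable [IsProbabilityMeasure μ]

theorem integrable_continuous_queue (hW : ∀ t, Measurable (W t)) (hq₀ : 0 ≤ q₀)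
    {f : (Fin K → ℝ) → ℝ} (hf : Continuous f) (t : ℕ) :
    Integrable (fun ω => f (N.queue q₀ (W · ω) t)) μ := by
  obtain ⟨c, hc⟩ := N.exists_bound_continuous_queue hq₀ hf t
  exact .of_bound (hf.measurable.comp (N.measurable_queue hW t)).aestronglyMeasurable c
    (ae_of_all _ fun ω => hc _)

theorem integral_lyapunov_queue_le (h : IsIID W N.law μ) (hq₀ : 0 ≤ q₀) {C : ℝ}
    (hC : N.QuarticDrift C) (t : ℕ) :
    ∫ ω, lyapunov (N.queue q₀ (W · ω) t) ∂μ ≤ ∫ ω, lyapunov (N.queue q₀ (W · ω) t) ^ 2 ∂μ -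
      ∫ ω, lyapunov (N.queue q₀ (W · ω) (t + 1)) ^ 2 ∂μ + C := by
  have hL := N.integrable_continuous_queue (μ := μ) h.measurable hq₀ continuous_lyapunov t
  have hsq : ∀ t, Integrable (fun ω => lyapunov (N.queue q₀ (W · ω) t) ^ 2) μ :=
    N.integrable_continuous_queue h.measurable hq₀ (continuous_lyapunov.pow 2)
  have hsqC : Integrable (fun ω => lyapunov (N.queue q₀ (W · ω) t) ^ 2 + C) μ :=
    (hsq t).add (integrable_const C)
  have hX := N.measurable_queue_past (q₀ := q₀) h.measurable t
  have hG : Measurable fun p : (Fin K → ℝ) × E => lyapunov (N.step p.1 p.2) ^ 2 :=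
    (continuous_lyapunov.pow 2).measurable.comp N.measurable_step
  have hstep : ∫ ω, lyapunov (N.queue q₀ (W · ω) (t + 1)) ^ 2 ∂μ ≤
      ∫ ω, (lyapunov (N.queue q₀ (W · ω) t) ^ 2 + C - lyapunov (N.queue q₀ (W · ω) t)) ∂μ :=
    (h.integral_comp hX hG (hsq (t + 1))).trans_le
      (integral_mono (h.integrable_integral hX hG (hsq (t + 1))) (hsqC.sub hL)
        fun ω => hC _ (N.queue_nonneg hq₀ _ t))
  rw [integral_sub hsqC hL, integral_add (hsq t) (integrable_const C), integral_const,
    probReal_univ, one_smul] at hstep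
  linarith

theorem summable_integral_lyapunov_queue (h : IsIID W N.law μ) (hq₀ : 0 ≤ q₀) {C : ℝ}
    (hC0 : 0 ≤ C) (hC : N.QuarticDrift C) :
    Summable fun t : ℕ => (∫ ω, lyapunov (N.queue q₀ (W · ω) t) ∂μ) * (((t : ℝ) + 1) ^ 2)⁻¹ :=
  summable_mul_of_drift (fun _ => integral_nonneg fun _ => lyapunov_nonneg _)
    (fun _ => integral_nonneg fun _ => sq_nonneg _) (fun _ => by positivity)
    antitone_inv_succ_sq summable_inv_succ_sq hC0 (N.integral_lyapunov_queue_le h hq₀ hC)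

theorem timeAverage_integral_lyapunov_queue_le (h : IsIID W N.law μ) (hq₀ : 0 ≤ q₀) {C : ℝ}
    (hC : N.QuarticDrift C) {n : ℕ} (hn : n ≠ 0) :
    timeAverage (fun τ => ∫ ω, lyapunov (N.queue q₀ (W · ω) τ) ∂μ) n ≤
      C + 1 / (n : ℝ) * ∫ ω, lyapunov (N.queue q₀ (W · ω) 1) ^ 2 ∂μ := by
  have havg := neg_smul_le_timeAverage_of_sub_le
    (f := fun τ => ∫ ω, lyapunov (N.queue q₀ (W · ω) τ) ^ 2 ∂μ)
    (c := fun τ => C - ∫ ω, lyapunov (N.queue q₀ (W · ω) τ) ∂μ)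
    (fun _ => integral_nonneg fun _ => sq_nonneg _)
    (fun τ => by linarith [N.integral_lyapunov_queue_le h hq₀ hC τ]) n
  rw [timeAverage_sub, timeAverage_const _ hn, smul_eq_mul] at havg
  linarith

theorem ae_tendsto_smul_queue (h : IsIID W N.law μ) (hq₀ : 0 ≤ q₀) {C : ℝ} (hC0 : 0 ≤ C)
    (hC : N.QuarticDrift C) :
    ∀ᵐ ω ∂μ, Tendsto (fun n : ℕ => (1 / (n : ℝ)) • N.queue q₀ (W · ω) (n + 1)) atTop (𝓝 0) := by
  have hsum := ae_summable_of_summable_integral (μ := μ)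
    (f := fun t ω => lyapunov (N.queue q₀ (W · ω) t) * (((t : ℝ) + 1) ^ 2)⁻¹)
    (fun t ω => mul_nonneg (lyapunov_nonneg _) (by positivity))
    (fun t => (N.integrable_continuous_queue h.measurable hq₀ continuous_lyapunov t).mul_const _)
    (by simpa only [integral_mul_const] using N.summable_integral_lyapunov_queue h hq₀ hC0 hC)
  filter_upwards [hsum] with ω hω
  refine tendsto_pi_nhds.2 fun k => ?_
  have hk : Summable fun t : ℕ => N.queue q₀ (W · ω) t k ^ 2 * (((t : ℝ) + 1) ^ 2)⁻¹ :=
    hω.of_nonneg_of_le (fun t => by positivity) fun t =>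
      mul_le_mul_of_nonneg_right (sq_le_lyapunov _ k) (by positivity)
  simpa only [Pi.smul_apply, smul_eq_mul, one_div_mul_eq_div, Pi.zero_apply] using
    tendsto_succ_div_of_summable_sq hk

theorem integral_noise_queue_sq_le (h : IsIID W N.law μ) (hq₀ : 0 ≤ q₀) (t : ℕ) :
    ∫ ω, N.noise (N.queue q₀ (W · ω) t) (W t ω) ^ 2 ∂μ ≤
      (∫ ω, lyapunov (N.queue q₀ (W · ω) t) ∂μ) * ∫ w, N.noiseBound w ∂N.law := by
  have hprod := N.integrable_lyapunov_queue_mul_noiseBound h hq₀ t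
  refine (integral_mono (N.memLp_noise_queue h hq₀ t).integrable_sq hprod fun ω =>
    N.noise_sq_le _ _).trans_eq ?_
  have hG : Measurable fun p : (Fin K → ℝ) × E => lyapunov p.1 * N.noiseBound p.2 :=
    (continuous_lyapunov.measurable.comp measurable_fst).mul
      (N.measurable_noiseBound.comp measurable_snd)
  have hindep := h.integral_comp (N.measurable_queue_past (q₀ := q₀) h.measurable t) hG hprod
  simp only [integral_const_mul] at hindep
  rw [hindep, integral_mul_const]

theorem isMartingaleDifference_noise (h : IsIID W N.law μ) (hq₀ : 0 ≤ q₀) :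
    IsMartingaleDifference (past W h.measurable)
      (fun t ω => N.noise (N.queue q₀ (W · ω) t) (W t ω)) μ where
  stronglyMeasurable t := (N.measurable_noise.comp
    (((N.measurable_queue_past h.measurable t).mono ((past W _).mono t.le_succ) le_rfl).prodMk
      (measurable_past_succ h.measurable t))).stronglyMeasurable
  memLp_two t := N.memLp_noise_queue h hq₀ t
  condExp_eq_zero t := h.condExp_past_eq_zero (N.measurable_queue_past h.measurable t)
    N.measurable_noise ((N.memLp_noise_queue h hq₀ t).integrable one_le_two)
    fun _ => N.integral_noise _

theorem ae_tendsto_timeAverage_noise (h : IsIID W N.law μ) (hq₀ : 0 ≤ q₀) {C : ℝ} (hC0 : 0 ≤ C)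
    (hC : N.QuarticDrift C) :
    ∀ᵐ ω ∂μ, Tendsto (timeAverage fun τ => N.noise (N.queue q₀ (W · ω) τ) (W τ ω)) atTop
      (𝓝 0) := by
  have hsum : Summable fun t : ℕ =>
      (∫ ω, N.noise (N.queue q₀ (W · ω) t) (W t ω) ^ 2 ∂μ) * (((t : ℝ) + 1) ^ 2)⁻¹ := by
    refine .of_nonneg_of_le
      (fun t => mul_nonneg (integral_nonneg fun _ => sq_nonneg _) (by positivity))
      (fun t => mul_le_mul_of_nonneg_right (N.integral_noise_queue_sq_le h hq₀ t) (by positivity))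
      ?_
    simpa only [mul_right_comm] using
      (N.summable_integral_lyapunov_queue h hq₀ hC0 hC).mul_right (∫ w, N.noiseBound w ∂N.law)
  exact ((N.isMartingaleDifference_noise h hq₀).ae_tendsto_cesaro_zero hsum).mono
    fun ω hω => tendsto_timeAverage_of_tendsto_cesaro hω

theorem ae_le_liminf_utility (h : IsIID W N.law μ) (hq₀ : 0 ≤ q₀) {C : ℝ} (hC0 : 0 ≤ C)
    (hC : N.QuarticDrift C) {x : Fin K → ℝ} (hx : x ∈ N.region ∩ box K N.A) (hUx : N.U x ≠ ⊥) :
    ∀ᵐ ω ∂μ, N.U x - (((1 / 2 * ∫ w, N.incr w ∂N.law) / N.V : ℝ) : EReal) ≤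
      liminf (fun n => N.U (timeAverage (fun τ => N.rate (N.queue q₀ (W · ω) τ) (W τ ω)) n))
        atTop := by
  filter_upwards [N.ae_tendsto_smul_queue h hq₀ hC0 hC,
    N.ae_tendsto_timeAverage_noise h hq₀ hC0 hC,
    h.ae_tendsto_timeAverage N.measurable_incr N.integrable_incr,
    N.ae_eventually_timeAverage_rate_mem (q₀ := q₀) h] with ω hqueue hnoise hincr hrate
  have hinit : Tendsto (fun n : ℕ => 1 / (n : ℝ) * (1 / 2 * lyapunov (N.queue q₀ (W · ω) 1)))
      atTop (𝓝 0) := by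
    simpa using (tendsto_one_div_atTop_nhds_zero_nat (𝕜 := ℝ)).mul_const
      (1 / 2 * lyapunov (N.queue q₀ (W · ω) 1))
  have hlower := (((((hincr.const_mul (1 / 2)).add hnoise).add hinit).div_const N.V).const_sub
    (N.U x).toReal)
  rw [add_zero, add_zero] at hlower
  have hlim := (continuous_coe_real_ereal.tendsto _).comp hlower
  rw [← N.coe_toReal_U hx.2 hUx, ← EReal.coe_sub, ← hlim.liminf_eq]
  refine (liminf_le_liminf ?_).trans (liminf_utility_add_le N.continuousOn_U hrate
    (fun n => smul_nonneg (by positivity) (N.queue_nonneg hq₀ _ _)) hqueue)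
  filter_upwards [eventually_ne_atTop 0] with n hn
  have hhyp : ∀ τ, (N.arrival (N.queue q₀ (W · ω) τ), N.util (N.queue q₀ (W · ω) τ)) ∈
      hypograph N.U := fun τ =>
    N.arrival_util_mem_hypograph (N.queue_nonneg hq₀ _ τ) hx.2 hUx
  have hle := N.timeAverage_arrival_le hq₀ (W · ω) n
  have hbox := timeAverage_mem (convex_box K N.A)
    (fun τ => N.arrival_mem (N.queue q₀ (W · ω) τ)) hn
  calc _ ≤ ((timeAverage (fun τ => N.util (N.queue q₀ (W · ω) τ)) n : ℝ) : EReal) :=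
        EReal.coe_le_coe_iff.2 (N.le_timeAverage_util hq₀ hx hUx _ hn)
    _ ≤ N.U (timeAverage (fun τ => N.arrival (N.queue q₀ (W · ω) τ)) n) :=
        coe_timeAverage_le_utility N.concaveOn_U hhyp hn
    _ ≤ _ := N.monotoneOn_U (box_subset_Ici K N.A hbox)
        ((box_subset_Ici K N.A hbox).trans hle) hle

end Trajectories

end QueueSystem

theorem limsup_coe_le_of_eventually_le_mul_add {ι : Type*} {F : Filter ι} [F.NeBot]
    {x y e : ι → ℝ} {b u e₀ : ℝ} (hb : 0 ≤ b) (h : ∀ᶠ i in F, x i ≤ b * y i + e i)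
    (hy : limsup (fun i => (y i : EReal)) F ≤ u) (he : Tendsto e F (𝓝 e₀)) :
    limsup (fun i => (x i : EReal)) F ≤ ((b * u + e₀ : ℝ) : EReal) := by
  have hlim : Tendsto (fun v : ℝ => ((b * v + e₀ : ℝ) : EReal)) (𝓝[>] u)
      (𝓝 ((b * u + e₀ : ℝ) : EReal)) :=
    (continuous_coe_real_ereal.comp (by fun_prop)).continuousAt.mono_left inf_le_left
  refine ge_of_tendsto hlim (eventually_mem_nhdsWithin.mono fun v hv => ?_)
  have hev := (continuous_coe_real_ereal.tendsto _).comp (he.const_add (b * v))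
  refine (limsup_le_limsup ?_).trans_eq hev.limsup_eq
  filter_upwards [h, eventually_lt_of_limsup_lt (hy.trans_lt (EReal.coe_lt_coe_iff.2 hv))]
    with i hi hyi
  refine EReal.coe_le_coe_iff.2 (hi.trans (add_le_add_left ?_ _))
  exact mul_le_mul_of_nonneg_left (EReal.coe_le_coe_iff.1 hyi.le) hb

namespace QueueSystem

variable {K : ℕ} {E : Type*} [MeasurableSpace E] (N : QueueSystem K E)

theorem exists_optimal (hne : N.region.Nonempty) :
    ∃ x ∈ N.region ∩ box K N.A, ∀ y ∈ N.region ∩ box K N.A, N.U y ≤ N.U x := by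
  obtain ⟨z, hz⟩ := hne
  exact ((isCompact_box K N.A).inter_left N.isClosed_region).exists_isMaxOn
    ⟨0, N.region_lower z hz 0 le_rfl (N.region_nonneg z hz), fun _ => ⟨le_rfl, N.A_pos.le⟩⟩
    (N.continuousOn_U.mono fun x hx => box_subset_Ici K N.A hx.2)

section Expectations

variable {Ω : Type*} {m0 : MeasurableSpace Ω} {μ : Measure Ω} {W : ℕ → Ω → E} {q₀ : Fin K → ℝ}

theorem integrable_rate_queue (h : IsIID W N.law μ) (t : ℕ) :
    Integrable (fun ω => N.rate (N.queue q₀ (W · ω) t) (W t ω)) μ := by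
  refine .of_eval fun k => (h.integrable_comp (N.integrable_rateBound k) t).mono'
    ((N.measurable_rate_apply k).comp
      ((N.measurable_queue h.measurable t).prodMk (h.measurable t))).aestronglyMeasurable
    (ae_of_all _ fun ω => ?_)
  rw [Real.norm_of_nonneg (N.rate_nonneg _ _ k)]
  exact N.rate_le _ _ k

variable [IsProbabilityMeasure μ]

theorem integrable_queue (hW : ∀ t, Measurable (W t)) (hq₀ : 0 ≤ q₀) (t : ℕ) :
    Integrable (fun ω => N.queue q₀ (W · ω) t) μ :=
  .of_eval fun k => N.integrable_continuous_queue hW hq₀ (continuous_apply k) t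

theorem integrable_arrival_queue (hW : ∀ t, Measurable (W t)) (t : ℕ) :
    Integrable (fun ω => N.arrival (N.queue q₀ (W · ω) t)) μ := by
  refine .of_bound (C := N.A)
    (N.measurable_arrival.comp (N.measurable_queue hW t)).aestronglyMeasurable
    (ae_of_all _ fun ω => (pi_norm_le_iff_of_nonneg N.A_pos.le).2 fun k => ?_)
  rw [Real.norm_of_nonneg (N.arrival_mem _ k).1]
  exact (N.arrival_mem _ k).2

theorem integrable_util_queue (hW : ∀ t, Measurable (W t)) (hq₀ : 0 ≤ q₀) {x : Fin K → ℝ}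
    (hx : x ∈ box K N.A) (hUx : N.U x ≠ ⊥) (t : ℕ) :
    Integrable (fun ω => N.util (N.queue q₀ (W · ω) t)) μ := by
  obtain ⟨m, hm⟩ := exists_coe_bound_on_box N.continuousOn_U N.U_ne_top N.A_pos.le
  have hbound : Continuous fun q : Fin K → ℝ =>
      |m| + |(N.U x).toReal| + (∑ k, q k * x k) / N.V := by fun_prop
  exact (N.integrable_continuous_queue hW hq₀ hbound t).mono'
    (N.measurable_util.comp (N.measurable_queue hW t)).aestronglyMeasurable
    (ae_of_all _ fun ω => N.abs_util_le hm (N.queue_nonneg hq₀ _ t) hx hUx)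

theorem integral_arrival_queue_mem_box (hW : ∀ t, Measurable (W t)) (t : ℕ) :
    ∫ ω, N.arrival (N.queue q₀ (W · ω) t) ∂μ ∈ box K N.A :=
  (convex_box K N.A).integral_mem (isCompact_box K N.A).isClosed
    (ae_of_all _ fun _ => N.arrival_mem _) (N.integrable_arrival_queue hW t)

theorem integral_rate_queue_mem_region (h : IsIID W N.law μ) (t : ℕ) :
    ∫ ω, N.rate (N.queue q₀ (W · ω) t) (W t ω) ∂μ ∈ N.region := by
  have hX := N.measurable_queue_past (q₀ := q₀) h.measurable t
  have hrate := N.integrable_rate_queue (q₀ := q₀) h t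
  have hmean : ∀ k, Integrable (fun ω => N.meanRate (N.queue q₀ (W · ω) t) k) μ := fun k =>
    h.integrable_integral hX (N.measurable_rate_apply k) (hrate.eval k)
  have heq : ∫ ω, N.rate (N.queue q₀ (W · ω) t) (W t ω) ∂μ =
      ∫ ω, N.meanRate (N.queue q₀ (W · ω) t) ∂μ := by
    ext k
    rw [eval_integral hrate.eval, eval_integral hmean]
    exact h.integral_comp hX (N.measurable_rate_apply k) (hrate.eval k)
  rw [heq]
  exact N.convex_region.integral_mem N.isClosed_region
    (ae_of_all _ fun ω => N.mean_rate_mem _) (.of_eval hmean)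

theorem integral_arrival_util_queue_mem_hypograph (hW : ∀ t, Measurable (W t)) (hq₀ : 0 ≤ q₀)
    {x : Fin K → ℝ} (hx : x ∈ box K N.A) (hUx : N.U x ≠ ⊥) (t : ℕ) :
    (∫ ω, N.arrival (N.queue q₀ (W · ω) t) ∂μ, ∫ ω, N.util (N.queue q₀ (W · ω) t) ∂μ) ∈
      hypograph N.U := by
  have harrival := N.integrable_arrival_queue (μ := μ) (q₀ := q₀) hW t
  have hutil := N.integrable_util_queue (μ := μ) hW hq₀ hx hUx t
  rw [← integral_pair harrival hutil]
  exact (convex_hypograph N.concaveOn_U).integral_mem (isClosed_hypograph N.continuousOn_U)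
    (ae_of_all _ fun ω => N.arrival_util_mem_hypograph (N.queue_nonneg hq₀ _ t) hx hUx)
    (harrival.prodMk hutil)

theorem timeAverage_integral_arrival_le (h : IsIID W N.law μ) (hq₀ : 0 ≤ q₀) (n : ℕ) :
    timeAverage (fun τ => ∫ ω, N.arrival (N.queue q₀ (W · ω) τ) ∂μ) n ≤
      timeAverage (fun τ => ∫ ω, N.rate (N.queue q₀ (W · ω) τ) (W τ ω) ∂μ) n +
        (1 / (n : ℝ)) • ∫ ω, N.queue q₀ (W · ω) (n + 1) ∂μ := by
  have hqueue := N.integrable_queue (μ := μ) h.measurable hq₀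
  have harrival := N.integrable_arrival_queue (μ := μ) (q₀ := q₀) h.measurable
  have hrate := N.integrable_rate_queue (q₀ := q₀) h
  refine timeAverage_le_timeAverage_add_smul
    (q := fun τ => ∫ ω, N.queue q₀ (W · ω) τ ∂μ)
    (fun τ => integral_nonneg fun ω => N.queue_nonneg hq₀ _ τ) (fun τ => ?_) n
  rw [← integral_sub (harrival τ) (hrate τ), ← integral_sub (hqueue (τ + 1)) (hqueue τ)]
  exact integral_mono ((harrival τ).sub (hrate τ)) ((hqueue (τ + 1)).sub (hqueue τ))
    fun ω => N.arrival_sub_rate_le _ τ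

theorem sq_integral_queue_le (hW : ∀ t, Measurable (W t)) (hq₀ : 0 ≤ q₀) (t : ℕ) (k : Fin K) :
    (∫ ω, N.queue q₀ (W · ω) t k ∂μ) ^ 2 ≤ ∫ ω, lyapunov (N.queue q₀ (W · ω) t) ∂μ := by
  have hsq : Integrable (fun ω => N.queue q₀ (W · ω) t k ^ 2) μ :=
    N.integrable_continuous_queue hW hq₀ (f := fun q => q k ^ 2) (by fun_prop) t
  calc _ ≤ ∫ ω, N.queue q₀ (W · ω) t k ^ 2 ∂μ :=
        (even_two.convexOn_pow (𝕜 := ℝ)).map_integral_le (by fun_prop) isClosed_univ (by simp)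
          ((N.integrable_queue hW hq₀ t).eval k) hsq
    _ ≤ _ := integral_mono hsq (N.integrable_continuous_queue hW hq₀ continuous_lyapunov t)
        fun ω => sq_le_lyapunov _ k

theorem tendsto_smul_integral_queue (h : IsIID W N.law μ) (hq₀ : 0 ≤ q₀) {C : ℝ} (hC0 : 0 ≤ C)
    (hC : N.QuarticDrift C) :
    Tendsto (fun n : ℕ => (1 / (n : ℝ)) • ∫ ω, N.queue q₀ (W · ω) (n + 1) ∂μ) atTop (𝓝 0) := by
  refine tendsto_pi_nhds.2 fun k => ?_
  have hsum : Summable fun t : ℕ =>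
      (∫ ω, N.queue q₀ (W · ω) t k ∂μ) ^ 2 * (((t : ℝ) + 1) ^ 2)⁻¹ :=
    (N.summable_integral_lyapunov_queue h hq₀ hC0 hC).of_nonneg_of_le (fun t => by positivity)
      fun t => mul_le_mul_of_nonneg_right (N.sq_integral_queue_le h.measurable hq₀ t k)
        (by positivity)
  simpa only [Pi.smul_apply, smul_eq_mul, one_div_mul_eq_div, Pi.zero_apply,
    eval_integral (N.integrable_queue (μ := μ) h.measurable hq₀ _).eval] using
    tendsto_succ_div_of_summable_sq hsum

theorem limsup_timeAverage_integral_util_le (h : IsIID W N.law μ) (hq₀ : 0 ≤ q₀) {C : ℝ}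
    (hC0 : 0 ≤ C) (hC : N.QuarticDrift C) {x : Fin K → ℝ} (hx : x ∈ N.region ∩ box K N.A)
    (hUx : N.U x ≠ ⊥) (hopt : ∀ y ∈ N.region ∩ box K N.A, N.U y ≤ N.U x) :
    limsup (fun n => ((timeAverage (fun τ => ∫ ω, N.util (N.queue q₀ (W · ω) τ) ∂μ) n : ℝ) :
      EReal)) atTop ≤ N.U x := by
  refine (limsup_le_limsup ?_).trans (limsup_utility_le N.continuousOn_U N.isClosed_region
    N.region_lower N.region_nonneg hopt
    (a := timeAverage fun τ => ∫ ω, N.arrival (N.queue q₀ (W · ω) τ) ∂μ) ?_ ?_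
    (.of_forall fun n => N.timeAverage_integral_arrival_le h hq₀ n)
    (N.tendsto_smul_integral_queue h hq₀ hC0 hC))
  · filter_upwards [eventually_ne_atTop 0] with n hn
    exact coe_timeAverage_le_utility N.concaveOn_U
      (N.integral_arrival_util_queue_mem_hypograph h.measurable hq₀ hx.2 hUx) hn
  · filter_upwards [eventually_ne_atTop 0] with n hn
    exact timeAverage_mem (convex_box K N.A) (N.integral_arrival_queue_mem_box h.measurable) hn
  · filter_upwards [eventually_ne_atTop 0] with n hn
    exact timeAverage_mem N.convex_region (N.integral_rate_queue_mem_region h) hn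

theorem integral_noise_queue (h : IsIID W N.law μ) (hq₀ : 0 ≤ q₀) (t : ℕ) :
    ∫ ω, N.noise (N.queue q₀ (W · ω) t) (W t ω) ∂μ = 0 := by
  rw [h.integral_comp (N.measurable_queue_past (q₀ := q₀) h.measurable t) N.measurable_noise
    ((N.memLp_noise_queue h hq₀ t).integrable one_le_two)]
  simp only [N.integral_noise, integral_zero]

theorem half_integral_lyapunov_queue_sub_le (h : IsIID W N.law μ) (hq₀ : 0 ≤ q₀)
    {R : Fin K → ℝ} (hR : R ∈ N.region) {β : ℝ} (hβR : β • R ∈ box K N.A)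
    (hU : N.U (β • R) ≠ ⊥) (t : ℕ) :
    1 / 2 * ∫ ω, lyapunov (N.queue q₀ (W · ω) (t + 1)) ∂μ -
        1 / 2 * ∫ ω, lyapunov (N.queue q₀ (W · ω) t) ∂μ ≤
      1 / 2 * ∫ w, N.incr w ∂N.law + N.V * ∫ ω, N.util (N.queue q₀ (W · ω) t) ∂μ -
        N.V * (N.U (β • R)).toReal -
          (1 - β) * ∑ k, R k * ∫ ω, N.queue q₀ (W · ω) t k ∂μ := by
  have hL := fun t => N.integrable_continuous_queue (μ := μ) h.measurable hq₀ continuous_lyapunov t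
  have hincr := h.integrable_comp N.integrable_incr t
  have hnoise := (N.memLp_noise_queue h hq₀ t).integrable one_le_two
  have hutil := N.integrable_util_queue (μ := μ) h.measurable hq₀ hβR hU t
  have hqueue := fun k => ((N.integrable_queue (μ := μ) h.measurable hq₀ t).eval k).const_mul (R k)
  have : Integrable (fun ω => ∑ k, R k * N.queue q₀ (W · ω) t k) μ :=
    integrable_finsetSum _ fun k _ => hqueue k
  have hslot : ∀ ω, 1 / 2 * lyapunov (N.queue q₀ (W · ω) (t + 1)) -
      1 / 2 * lyapunov (N.queue q₀ (W · ω) t) ≤ 1 / 2 * N.incr (W t ω) +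
        N.noise (N.queue q₀ (W · ω) t) (W t ω) + N.V * N.util (N.queue q₀ (W · ω) t) -
        N.V * (N.U (β • R)).toReal - (1 - β) * ∑ k, R k * N.queue q₀ (W · ω) t k := fun ω => by
    have hweight : ∑ k, N.queue q₀ (W · ω) t k * ((β • R) k - R k) =
        -((1 - β) * ∑ k, R k * N.queue q₀ (W · ω) t k) := by
      rw [Finset.mul_sum, ← Finset.sum_neg_distrib]
      exact Finset.sum_congr rfl fun k _ => by rw [Pi.smul_apply, smul_eq_mul]; ring
    have := N.half_lyapunov_step_sub_le (N.queue_nonneg hq₀ (W · ω) t) hβR hU hR (W t ω)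
    rw [hweight] at this
    exact this.trans_eq (by ring)
  have hmean := integral_mono (μ := μ) (by fun_prop) (by fun_prop) hslot
  rw [integral_sub (by fun_prop) (by fun_prop), integral_sub (by fun_prop) (by fun_prop),
    integral_sub (by fun_prop) (by fun_prop), integral_add (by fun_prop) (by fun_prop),
    integral_add (by fun_prop) (by fun_prop)] at hmean
  simpa only [integral_const_mul, integral_const, probReal_univ, one_smul,
    h.integral_comp_eq N.measurable_incr, N.integral_noise_queue h hq₀, add_zero,
    integral_finsetSum _ fun k _ => hqueue k] using hmean

theorem timeAverage_integral_queue_le (h : IsIID W N.law μ) (hq₀ : 0 ≤ q₀)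
    {R : Fin K → ℝ} (hR : R ∈ N.region) {β : ℝ} (hβ : β < 1) (hβR : β • R ∈ box K N.A)
    (hU : N.U (β • R) ≠ ⊥) {n : ℕ} (hn : n ≠ 0) :
    timeAverage (fun τ => ∑ k, R k * ∫ ω, N.queue q₀ (W · ω) τ k ∂μ) n ≤
      N.V / (1 - β) * timeAverage (fun τ => ∫ ω, N.util (N.queue q₀ (W · ω) τ) ∂μ) n +
        (1 / 2 * ∫ w, N.incr w ∂N.law - N.V * (N.U (β • R)).toReal +
          1 / (n : ℝ) * (1 / 2 * ∫ ω, lyapunov (N.queue q₀ (W · ω) 1) ∂μ)) / (1 - β) := by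
  have havg := neg_smul_le_timeAverage_of_sub_le
    (f := fun t => 1 / 2 * ∫ ω, lyapunov (N.queue q₀ (W · ω) t) ∂μ)
    (fun _ => mul_nonneg one_half_pos.le (integral_nonneg fun _ => lyapunov_nonneg _))
    (N.half_integral_lyapunov_queue_sub_le h hq₀ hR hβR hU) n
  rw [timeAverage_sub, timeAverage_sub, timeAverage_add, timeAverage_mul_left,
    timeAverage_mul_left, timeAverage_const _ hn, timeAverage_const _ hn, smul_eq_mul,
    timeAverage_mul_left (1 - β)] at havg
  rw [div_mul_eq_mul_div, ← add_div, le_div_iff₀ (sub_pos.2 hβ)]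
  linarith

theorem limsup_timeAverage_integral_queue_le (h : IsIID W N.law μ) (hq₀ : 0 ≤ q₀) {C : ℝ}
    (hC0 : 0 ≤ C) (hC : N.QuarticDrift C) {x : Fin K → ℝ} (hx : x ∈ N.region ∩ box K N.A)
    (hUx : N.U x ≠ ⊥) (hopt : ∀ y ∈ N.region ∩ box K N.A, N.U y ≤ N.U x) {R : Fin K → ℝ}
    (hR : R ∈ N.region) {β : ℝ} (hβ : β < 1) (hβR : β • R ∈ box K N.A) :
    limsup (fun n => ((timeAverage (fun τ => ∑ k, R k * ∫ ω, N.queue q₀ (W · ω) τ k ∂μ) n : ℝ) :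
      EReal)) atTop ≤ (((1 / 2 * ∫ w, N.incr w ∂N.law : ℝ) : EReal) +
        (N.V : EReal) * (N.U x - N.U (β • R))) / ((1 - β : ℝ) : EReal) := by
  have hβ' : 0 < 1 - β := sub_pos.2 hβ
  have hux := N.coe_toReal_U hx.2 hUx
  by_cases hU : N.U (β • R) = ⊥
  · rw [hU, ← hux, EReal.coe_sub_bot, EReal.coe_mul_top_of_pos N.V_pos, EReal.coe_add_top,
      EReal.top_div_of_pos_ne_top (EReal.coe_pos.2 hβ') (EReal.coe_ne_top _)]
    exact le_top
  have hinit : Tendsto (fun n : ℕ => 1 / (n : ℝ) *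
      (1 / 2 * ∫ ω, lyapunov (N.queue q₀ (W · ω) 1) ∂μ)) atTop (𝓝 0) := by
    simpa using (tendsto_one_div_atTop_nhds_zero_nat (𝕜 := ℝ)).mul_const
      (1 / 2 * ∫ ω, lyapunov (N.queue q₀ (W · ω) 1) ∂μ)
  refine (limsup_coe_le_of_eventually_le_mul_add (div_nonneg N.V_pos.le hβ'.le)
    ((eventually_ne_atTop 0).mono fun n hn =>
      N.timeAverage_integral_queue_le h hq₀ hR hβ hβR hU hn)
    ((N.limsup_timeAverage_integral_util_le h hq₀ hC0 hC hx hUx hopt).trans_eq hux.symm)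
    ((hinit.const_add _).div_const _)).trans_eq ?_
  rw [← hux, ← N.coe_toReal_U hβR hU, ← EReal.coe_sub, ← EReal.coe_mul, ← EReal.coe_add,
    ← EReal.coe_div, EReal.coe_eq_coe_iff]
  simp only [EReal.toReal_coe]
  ring

theorem stronglyStable_queue (h : IsIID W N.law μ) (hq₀ : 0 ≤ q₀) {C : ℝ}
    (hC : N.QuarticDrift C) (k : Fin K) :
    StronglyStable μ fun t ω => N.queue q₀ (W · ω) t k := by
  refine ⟨fun t => (N.integrable_queue h.measurable hq₀ t).eval k, ?_⟩
  set e := ∫ ω, lyapunov (N.queue q₀ (W · ω) 1) ^ 2 ∂μ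
  have hle : ∀ τ, ∫ ω, N.queue q₀ (W · ω) τ k ∂μ ≤
      1 + ∫ ω, lyapunov (N.queue q₀ (W · ω) τ) ∂μ := fun τ => by
    nlinarith [N.sq_integral_queue_le (μ := μ) h.measurable hq₀ τ k,
      sq_nonneg ((∫ ω, N.queue q₀ (W · ω) τ k ∂μ) - 1)]
  refine (limsup_le_of_le (h := ?_)).trans_lt (EReal.coe_lt_top (1 + (C + 1 * e)))
  filter_upwards [eventually_ne_atTop 0] with n hn
  refine EReal.coe_le_coe_iff.2 ((timeAverage_mono hle n).trans ?_)
  rw [timeAverage_add, timeAverage_const _ hn]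
  have he : 0 ≤ e := integral_nonneg fun _ => sq_nonneg _
  have hn1 : 1 / (n : ℝ) ≤ 1 := div_le_one_of_le₀ (Nat.one_le_cast.2 (by lia)) (by positivity)
  linarith [N.timeAverage_integral_lyapunov_queue_le h hq₀ hC hn,
    mul_le_mul_of_nonneg_right hn1 he]

end Expectations

end QueueSystem

section Bounds

variable {M K : ℕ}

theorem sqNorm_nonneg (x : Fin M → ℂ) : 0 ≤ sqNorm x := Finset.sum_nonneg fun _ _ => sq_nonneg _

theorem sqNorm_steering_le_one (H : Channel M K) (S : Finset (Fin K)) (k : Fin K) :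
    sqNorm (steering H S k) ≤ 1 := by
  have hdiv : sqNorm (steering H S k) = sqNorm (zfColumn H S k) / sqNorm (zfColumn H S k) := by
    conv_lhs => unfold sqNorm steering
    simp only [norm_div, Complex.norm_real, Real.norm_eq_abs, div_pow, sq_abs,
      Real.sq_sqrt (sqNorm_nonneg _)]
    rw [← Finset.sum_div, ← sqNorm]
  exact hdiv.trans_le (div_self_le_one _)

theorem norm_dotProduct_sq_le (x y : Fin M → ℂ) :
    ‖star x ⬝ᵥ y‖ ^ 2 ≤ sqNorm x * sqNorm y := by
  have hnorm : ‖star x ⬝ᵥ y‖ ≤ ∑ m, ‖x m‖ * ‖y m‖ :=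
    (norm_sum_le _ _).trans_eq (Finset.sum_congr rfl fun m _ => by
      rw [norm_mul, Pi.star_apply, norm_star])
  exact (pow_le_pow_left₀ (norm_nonneg _) hnorm 2).trans (Finset.sum_mul_sq_le_sq_mul_sq _ _ _)

/-- The mutual information of a user who receives all the transmit power of its base station along
its own channel vector `h`; it is the largest mutual information the user can have. -/
noncomputable def infoBound (g : ℝ) (h : Fin M → ℂ) (χ : ℝ) : ℝ :=
  Real.logb 2 (1 + g * sqNorm h / (1 + χ))

section InfoBound

variable {g χ : ℝ} (hg : 0 ≤ g) (hχ : 0 ≤ χ)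
include hg hχ

theorem infoBound_nonneg (h : Fin M → ℂ) : 0 ≤ infoBound g h χ :=
  Real.logb_nonneg one_lt_two (le_add_of_nonneg_right
    (div_nonneg (mul_nonneg hg (sqNorm_nonneg h)) (by linarith)))

theorem mutualInfo_le_infoBound (H : Channel M K) {P : Fin K → ℝ} {k : Fin K} (hP0 : 0 ≤ P k)
    (hP1 : P k ≤ 1) : mutualInfo g H χ P k ≤ infoBound g (H k) χ := by
  have hgain : ‖star (H k) ⬝ᵥ steering H (active P) k‖ ^ 2 * P k ≤ sqNorm (H k) :=
    calc _ ≤ ‖star (H k) ⬝ᵥ steering H (active P) k‖ ^ 2 := mul_le_of_le_one_right (sq_nonneg _) hP1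
      _ ≤ sqNorm (H k) * sqNorm (steering H (active P) k) := norm_dotProduct_sq_le _ _
      _ ≤ sqNorm (H k) :=
        mul_le_of_le_one_right (sqNorm_nonneg _) (sqNorm_steering_le_one _ _ _)
  unfold mutualInfo infoBound
  rw [mul_assoc]
  exact Real.logb_le_logb_of_le one_lt_two (by positivity) (by gcongr)

theorem infoBound_le_logb (h : Fin M → ℂ) :
    infoBound g h χ ≤ Real.logb 2 (1 + g * sqNorm h) := by
  have hs : 0 ≤ g * sqNorm h := mul_nonneg hg (sqNorm_nonneg h)
  refine Real.logb_le_logb_of_le one_lt_two (by positivity) ?_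
  gcongr
  exact div_le_self hs (by linarith)

end InfoBound

theorem log_pow_four_le {x : ℝ} (hx : 1 ≤ x) : Real.log x ^ 4 ≤ 256 * x := by
  have hx0 : 0 ≤ x := zero_le_one.trans hx
  calc Real.log x ^ 4 ≤ (x ^ (1 / 4 : ℝ) / (1 / 4)) ^ 4 :=
        pow_le_pow_left₀ (Real.log_nonneg hx) (Real.log_le_rpow_div hx0 (by norm_num)) 4
    _ = 256 * (x ^ (1 / 4 : ℝ)) ^ 4 := by ring
    _ = 256 * x := by rw [← Real.rpow_natCast, ← Real.rpow_mul hx0]; norm_num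

theorem infoBound_pow_four_le {g χ : ℝ} (hg : 0 ≤ g) (hχ : 0 ≤ χ) (h : Fin M → ℂ) :
    infoBound g h χ ^ 4 ≤ 256 / Real.log 2 ^ 4 * (1 + g * sqNorm h) := by
  have hs : 0 ≤ g * sqNorm h := mul_nonneg hg (sqNorm_nonneg h)
  calc infoBound g h χ ^ 4 ≤ Real.logb 2 (1 + g * sqNorm h) ^ 4 :=
        pow_le_pow_left₀ (infoBound_nonneg hg hχ h) (infoBound_le_logb hg hχ h) 4
    _ = Real.log (1 + g * sqNorm h) ^ 4 / Real.log 2 ^ 4 := by rw [Real.logb, div_pow]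
    _ ≤ 256 * (1 + g * sqNorm h) / Real.log 2 ^ 4 := by
        gcongr
        exact log_pow_four_le (le_add_of_nonneg_right hs)
    _ = _ := (div_mul_eq_mul_div _ _ _).symm

theorem Feasible.power_le_one {a : Action K} (ha : Feasible M a) (k : Fin K) : a.1 k ≤ 1 :=
  (Finset.single_le_sum (f := a.1) (fun j _ => ha.1 j) (Finset.mem_univ k)).trans ha.2.1

theorem Feasible.rate_nonneg {a : Action K} (ha : Feasible M a) (k : Fin K) : 0 ≤ a.2 k :=
  ha.2.2.2 k

theorem outageRate_nonneg (g : ℝ) (H : Channel M K) (χ : ℝ) {a : Action K} {k : Fin K}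
    (ha : 0 ≤ a.2 k) : 0 ≤ outageRate g H χ a k :=
  ite_nonneg ha le_rfl

theorem outageRate_le_infoBound {g χ : ℝ} (hg : 0 ≤ g) (hχ : 0 ≤ χ) (H : Channel M K)
    {a : Action K} (ha : Feasible M a) (k : Fin K) :
    outageRate g H χ a k ≤ infoBound g (H k) χ := by
  unfold outageRate
  split_ifs with h
  · exact h.trans (mutualInfo_le_infoBound hg hχ H (ha.1 k) (ha.power_le_one k))
  · exact infoBound_nonneg hg hχ _

open scoped ComplexOrder in
theorem posSemidef_txCov (H : Channel M K) {P : Fin K → ℝ} (hP : 0 ≤ P) :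
    (txCov H P).PosSemidef :=
  Matrix.posSemidef_sum _ fun k _ =>
    (Matrix.posSemidef_vecMulVec_self_star _).smul (Complex.zero_le_real.2 (hP k))

theorem ici_nonneg {C : ℕ} {g : Fin K → Fin C → Fin C → ℝ} (hg : ∀ k c c', 0 ≤ g k c c')
    (c : Fin C) (γ : {c' : Fin C // c' ≠ c} → Policy M K) (w : Slot M K C) (k : Fin K) :
    0 ≤ ici g c γ w k :=
  Finset.sum_nonneg fun c' _ => mul_nonneg (hg _ _ _)
    ((posSemidef_txCov _ ((γ c').feasible _ _).1).re_dotProduct_nonneg _)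

end Bounds

section Measurability

variable {M K C : ℕ}

@[fun_prop]
theorem measurable_sqNorm : Measurable (sqNorm : (Fin M → ℂ) → ℝ) := by
  unfold sqNorm
  fun_prop

theorem measurable_zfColumn (S : Finset (Fin K)) (k : Fin K) :
    Measurable fun H : Channel M K => zfColumn H S k := by
  unfold zfColumn
  by_cases hk : k ∈ S
  swap
  · simp only [hk, dite_false, measurable_const]
  have hHS : Continuous fun H : Channel M K =>
      (Matrix.of fun m j => H j.1 m : Matrix (Fin M) S ℂ) :=
    continuous_matrix fun i j => by simp only [Matrix.of_apply]; fun_prop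
  have hgram := hHS.matrix_conjTranspose.matrix_mul hHS
  simp only [hk, dite_true, Matrix.mul_apply, Matrix.inv_def, Ring.inverse_eq_inv',
    Matrix.smul_apply, smul_eq_mul]
  exact measurable_pi_lambda _ fun m => Finset.measurable_sum _ fun j _ =>
    (hHS.matrix_elem m j).measurable.mul
      (hgram.matrix_det.measurable.inv.mul (hgram.matrix_adjugate.matrix_elem _ _).measurable)

theorem measurable_steering (S : Finset (Fin K)) (k : Fin K) :
    Measurable fun H : Channel M K => steering H S k := by
  have hzf := measurable_zfColumn (M := M) S k
  unfold steering
  fun_prop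

theorem measurable_active : Measurable (active (K := K)) := by
  refine measurable_finset_iff.2 fun k => ?_
  simp only [active, Finset.mem_filter_univ]
  exact measurableSet_setOfPred.1 (measurableSet_lt measurable_const (measurable_pi_apply k))

section Comp

variable {α : Type*} [MeasurableSpace α] {H : α → Channel M K} (hH : Measurable H)
include hH

theorem measurable_steering_active {P : α → Fin K → ℝ} (hP : Measurable P) (k : Fin K) :
    Measurable fun x => steering (H x) (active (P x)) k := by
  have huncurry : Measurable fun p : Channel M K × Finset (Fin K) => steering p.1 p.2 k :=
    measurable_from_prod_countable_left fun S => measurable_steering S k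
  generalize steering (M := M) (K := K) = v at huncurry ⊢
  exact huncurry.comp (hH.prodMk (measurable_active.comp hP))

theorem measurable_txCov_apply {P : α → Fin K → ℝ} (hP : Measurable P) (m m' : Fin M) :
    Measurable fun x => txCov (H x) (P x) m m' := by
  have hsteer := measurable_steering_active hH hP
  simp only [txCov, Matrix.sum_apply, Matrix.smul_apply, Matrix.vecMulVec_apply, Pi.star_apply,
    smul_eq_mul]
  fun_prop

theorem measurable_mutualInfo {χ : α → ℝ} (hχ : Measurable χ) {P : α → Fin K → ℝ}
    (hP : Measurable P) (g : ℝ) (k : Fin K) :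
    Measurable fun x => mutualInfo g (H x) (χ x) (P x) k := by
  have hsteer := measurable_steering_active hH hP k
  simp only [mutualInfo, Real.logb, dotProduct, Pi.star_apply]
  fun_prop

theorem measurable_outageRate {χ : α → ℝ} (hχ : Measurable χ) {a : α → Action K}
    (ha : Measurable a) (g : ℝ) (k : Fin K) :
    Measurable fun x => outageRate g (H x) (χ x) (a x) k :=
  Measurable.ite (measurableSet_le (by fun_prop) (measurable_mutualInfo hH hχ ha.fst g k))
    (by fun_prop) measurable_const

end Comp

theorem measurable_ownChannel (c : Fin C) :
    Measurable (ownChannel c : Slot M K C → Channel M K) := by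
  unfold ownChannel
  fun_prop

theorem Policy.measurable_act_slot (η : Policy M K) (c : Fin C) :
    Measurable fun w : Slot M K C => η.act (ownChannel c w) (w.2 c) :=
  η.measurable_act.comp ((measurable_ownChannel c).prodMk (by fun_prop))

theorem measurable_ici (g : Fin K → Fin C → Fin C → ℝ) (c : Fin C)
    (γ : {c' : Fin C // c' ≠ c} → Policy M K) (k : Fin K) :
    Measurable fun w => ici g c γ w k := by
  have hcov := fun c' : {c' : Fin C // c' ≠ c} => measurable_txCov_apply
    (measurable_ownChannel c'.1) ((γ c').measurable_act_slot c'.1).fst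
  simp only [ici, dotProduct, Matrix.mulVec, Pi.star_apply]
  fun_prop

theorem measurable_infoBound (g : Fin K → Fin C → Fin C → ℝ) (c : Fin C)
    (γ : {c' : Fin C // c' ≠ c} → Policy M K) (k : Fin K) :
    Measurable fun w : Slot M K C => infoBound (g k c c) (w.1 k c c) (ici g c γ w k) := by
  have hici := measurable_ici g c γ k
  unfold infoBound Real.logb
  fun_prop

end Measurability

section Law

variable {M K C : ℕ}

theorem measurable_complex_mk : Measurable fun p : ℝ × ℝ => (⟨p.1, p.2⟩ : ℂ) :=
  Complex.measurableEquivRealProd.symm.measurable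

instance : IsProbabilityMeasure cGauss :=
  Measure.isProbabilityMeasure_map measurable_complex_mk.aemeasurable

instance : IsProbabilityMeasure (slotLaw M K C) := by
  unfold slotLaw
  infer_instance

theorem integrable_norm_sq_cGauss : Integrable (fun z : ℂ => ‖z‖ ^ 2) cGauss := by
  rw [cGauss, integrable_map_measure (by fun_prop) measurable_complex_mk.aemeasurable]
  have hsq : Integrable (fun x : ℝ => x ^ 2) (gaussianReal 0 (1 / 2)) :=
    (memLp_id_gaussianReal (μ := 0) (v := 1 / 2) 2).integrable_sq
  refine ((hsq.comp_fst _).add (hsq.comp_snd _)).congr (ae_of_all _ fun p => ?_)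
  simp only [Function.comp_apply, Complex.sq_norm, Complex.normSq_apply, Pi.add_apply]
  ring

theorem measurePreserving_coefficient (k : Fin K) (c c' : Fin C) (m : Fin M) :
    MeasurePreserving (fun w : Slot M K C => w.1 k c c' m) (slotLaw M K C) cGauss :=
  (measurePreserving_eval (fun _ : Fin M => cGauss) m).comp
    ((measurePreserving_eval (fun _ : Fin C => Measure.pi fun _ : Fin M => cGauss) c').comp
      ((measurePreserving_eval (fun _ : Fin C => Measure.pi fun _ : Fin C =>
          Measure.pi fun _ : Fin M => cGauss) c).comp
        ((measurePreserving_eval (fun _ : Fin K => Measure.pi fun _ : Fin C =>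
          Measure.pi fun _ : Fin C => Measure.pi fun _ : Fin M => cGauss) k).comp
          measurePreserving_fst)))

theorem integrable_sqNorm (k : Fin K) (c c' : Fin C) :
    Integrable (fun w : Slot M K C => sqNorm (w.1 k c c')) (slotLaw M K C) :=
  integrable_finsetSum _ fun m _ =>
    (measurePreserving_coefficient k c c' m).integrable_comp_of_integrable integrable_norm_sq_cGauss

end Law

section Resampling

theorem measurePreserving_prodProdProdComm {α β : Type*} [MeasurableSpace α] [MeasurableSpace β]
    (μ : Measure α) (ν : Measure β) [SFinite μ] [SFinite ν] :
    MeasurePreserving (fun p : (α × β) × α × β => ((p.1.1, p.2.1), (p.1.2, p.2.2)))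
      ((μ.prod ν).prod (μ.prod ν)) ((μ.prod μ).prod (ν.prod ν)) := by
  have hmiddle : MeasurePreserving (fun p : β × α × β => (p.2.1, p.1, p.2.2))
      (ν.prod (μ.prod ν)) (μ.prod (ν.prod ν)) :=
    (measurePreserving_prodAssoc μ ν ν).comp
      ((Measure.measurePreserving_swap.prod (.id ν)).comp (measurePreserving_prodAssoc ν μ ν).symm)
  exact (measurePreserving_prodAssoc μ μ (ν.prod ν)).symm.comp
    (((MeasurePreserving.id μ).prod hmiddle).comp (measurePreserving_prodAssoc μ ν (μ.prod ν)))

theorem measurePreserving_pi_merge {ι α : Type*} [Fintype ι] [MeasurableSpace α]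
    (μ : ι → Measure α) [∀ i, SigmaFinite (μ i)] {f : ι → α × α → α}
    (hf : ∀ i, MeasurePreserving (f i) ((μ i).prod (μ i)) (μ i)) :
    MeasurePreserving (fun (p : (ι → α) × (ι → α)) i => f i (p.1 i, p.2 i))
      ((Measure.pi μ).prod (Measure.pi μ)) (Measure.pi μ) :=
  (measurePreserving_pi _ _ hf).comp (measurePreserving_arrowProdEquivProdArrow α α ι μ μ).symm

theorem measurePreserving_ite {α : Type*} [MeasurableSpace α] (μ : Measure α)
    [IsProbabilityMeasure μ] (P : Prop) [Decidable P] :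
    MeasurePreserving (fun p : α × α => if P then p.1 else p.2) (μ.prod μ) μ := by
  by_cases h : P
  · simpa only [h, if_true] using measurePreserving_fst
  · simpa only [h, if_false] using measurePreserving_snd

variable {M K C : ℕ}

/-- The slot with the own-cell channels and the seed of cell `c` from the first slot, and everything
else from the second one. It turns the independence of the interference power from the own-cell
randomness into an invariance of `slotLaw`. -/
def mergeSlot (c : Fin C) (p : Slot M K C × Slot M K C) : Slot M K C :=
  (fun k c₁ c₂ => if c₁ = c ∧ c₂ = c then p.1.1 k c₁ c₂ else p.2.1 k c₁ c₂,
    fun c' => if c' = c then p.1.2 c' else p.2.2 c')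

theorem measurePreserving_mergeSlot (c : Fin C) :
    MeasurePreserving (mergeSlot c) ((slotLaw M K C).prod (slotLaw M K C)) (slotLaw M K C) := by
  have hchannels := measurePreserving_pi_merge (fun _ : Fin K => Measure.pi fun _ : Fin C =>
      Measure.pi fun _ : Fin C => Measure.pi fun _ : Fin M => cGauss)
    fun _ => measurePreserving_pi_merge _ fun c₁ => measurePreserving_pi_merge _ fun c₂ =>
      measurePreserving_ite (Measure.pi fun _ : Fin M => cGauss) (c₁ = c ∧ c₂ = c)
  have hseeds := measurePreserving_pi_merge (fun _ : Fin C => (volume : Measure unitInterval))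
    fun c' => measurePreserving_ite _ (c' = c)
  exact (hchannels.prod hseeds).comp (measurePreserving_prodProdProdComm _ _)

theorem ownChannel_mergeSlot (c : Fin C) (p : Slot M K C × Slot M K C) :
    ownChannel c (mergeSlot c p) = ownChannel c p.1 := by
  ext k m
  simp [ownChannel, mergeSlot]

theorem ownChannel_mergeSlot_of_ne {c c' : Fin C} (h : c' ≠ c) (p : Slot M K C × Slot M K C) :
    ownChannel c' (mergeSlot c p) = ownChannel c' p.2 := by
  ext k m
  simp [ownChannel, mergeSlot, h]

theorem ici_mergeSlot (g : Fin K → Fin C → Fin C → ℝ) (c : Fin C)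
    (γ : {c' : Fin C // c' ≠ c} → Policy M K) (p : Slot M K C × Slot M K C) :
    ici g c γ (mergeSlot c p) = ici g c γ p.2 := by
  ext k
  refine Finset.sum_congr rfl fun c' _ => ?_
  rw [ownChannel_mergeSlot_of_ne c'.2]
  simp [mergeSlot, c'.2]

end Resampling

variable {M K C : ℕ} {g : Fin K → Fin C → Fin C → ℝ} {c : Fin C}
  {γ : {c' : Fin C // c' ≠ c} → Policy M K}

section Throughput

theorem integrable_infoBound_pow_four (hg : ∀ k c c', 0 ≤ g k c c') (k : Fin K) :
    Integrable (fun w : Slot M K C => infoBound (g k c c) (w.1 k c c) (ici g c γ w k) ^ 4)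
      (slotLaw M K C) := by
  have hbound : Integrable (fun w : Slot M K C =>
      256 / Real.log 2 ^ 4 * (1 + g k c c * sqNorm (w.1 k c c))) (slotLaw M K C) :=
    ((integrable_const 1).add ((integrable_sqNorm k c c).const_mul _)).const_mul _
  refine hbound.mono' ((measurable_infoBound g c γ k).pow_const 4).aestronglyMeasurable
    (ae_of_all _ fun w => ?_)
  rw [Real.norm_of_nonneg (pow_nonneg (infoBound_nonneg (hg _ _ _) (ici_nonneg hg c γ w k) _) 4)]
  exact infoBound_pow_four_le (hg _ _ _) (ici_nonneg hg c γ w k) _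

/-- The service rate of user `k` of cell `c` under the policy `η` when the channels and the seed of
the cell come from the slot `p.1` and the interference power from the slot `p.2`. -/
noncomputable def splitRate (g : Fin K → Fin C → Fin C → ℝ) (c : Fin C)
    (γ : {c' : Fin C // c' ≠ c} → Policy M K) (η : Policy M K) (k : Fin K)
    (p : Slot M K C × Slot M K C) : ℝ :=
  outageRate (g k c c) (ownChannel c p.1) (ici g c γ p.2 k) (η.act (ownChannel c p.1) (p.1.2 c)) k

theorem measurable_splitRate (η : Policy M K) (k : Fin K) :
    Measurable (splitRate g c γ η k) :=
  measurable_outageRate ((measurable_ownChannel c).comp measurable_fst)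
    ((measurable_ici g c γ k).comp measurable_snd)
    ((η.measurable_act_slot c).comp measurable_fst) _ k

theorem splitRate_mergeSlot (η : Policy M K) (k : Fin K) (p : Slot M K C × Slot M K C) :
    splitRate g c γ η k (mergeSlot c p, mergeSlot c p) = splitRate g c γ η k p := by
  simp only [splitRate, ownChannel_mergeSlot, ici_mergeSlot]
  simp [mergeSlot]

theorem integrable_splitRate_diag (hg : ∀ k c c', 0 ≤ g k c c') (η : Policy M K) (k : Fin K) :
    Integrable (fun w => splitRate g c γ η k (w, w)) (slotLaw M K C) := by
  have hbound := integrable_of_integrable_pow_four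
    (measurable_infoBound g c γ k).aestronglyMeasurable (integrable_infoBound_pow_four hg k)
  refine hbound.mono' ((measurable_splitRate η k).comp
    (measurable_id.prodMk measurable_id)).aestronglyMeasurable (ae_of_all _ fun w => ?_)
  unfold splitRate
  rw [Real.norm_of_nonneg (outageRate_nonneg _ _ _ ((η.feasible _ _).rate_nonneg k))]
  exact outageRate_le_infoBound (hg _ _ _) (ici_nonneg hg c γ w k) _ (η.feasible _ _) k

theorem integrable_splitRate (hg : ∀ k c c', 0 ≤ g k c c') (η : Policy M K) (k : Fin K) :
    Integrable (splitRate g c γ η k) ((slotLaw M K C).prod (slotLaw M K C)) := by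
  simpa only [Function.comp_def, splitRate_mergeSlot] using
    (measurePreserving_mergeSlot c).integrable_comp_of_integrable
      (integrable_splitRate_diag (γ := γ) hg η k)

theorem throughput_eq_integral_integral (hg : ∀ k c c', 0 ≤ g k c c') (η : Policy M K)
    (k : Fin K) :
    throughput g c γ η k =
      ∫ w, ∫ w', splitRate g c γ η k (w, w') ∂(slotLaw M K C) ∂(slotLaw M K C) := by
  have hmerge := measurePreserving_mergeSlot (M := M) (K := K) c
  calc throughput g c γ η k = ∫ w, splitRate g c γ η k (w, w) ∂(slotLaw M K C) := rfl
    _ = ∫ p, splitRate g c γ η k (mergeSlot c p, mergeSlot c p)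
          ∂(slotLaw M K C).prod (slotLaw M K C) := by
        conv_lhs => rw [← hmerge.map_eq]
        refine integral_map hmerge.measurable.aemeasurable ?_
        rw [hmerge.map_eq]
        exact (integrable_splitRate_diag hg η k).aestronglyMeasurable
    _ = ∫ p, splitRate g c γ η k p ∂(slotLaw M K C).prod (slotLaw M K C) := by
        simp only [splitRate_mergeSlot]
    _ = _ := integral_prod _ (integrable_splitRate hg η k)

theorem integrable_weightedRate (hg : ∀ k c c', 0 ≤ g k c c') (η : Policy M K)
    (q : Fin K → ℝ) :
    Integrable (fun w => weightedRate g c γ (ownChannel c w) q (η.act (ownChannel c w) (w.2 c)))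
      (slotLaw M K C) :=
  integrable_finsetSum _ fun k _ => (integrable_splitRate hg η k).integral_prod_left.const_mul _

theorem sum_mul_throughput_eq (hg : ∀ k c c', 0 ≤ g k c c') (η : Policy M K) (q : Fin K → ℝ) :
    ∑ k, q k * throughput g c γ η k = ∫ w, weightedRate g c γ (ownChannel c w) q
      (η.act (ownChannel c w) (w.2 c)) ∂(slotLaw M K C) := by
  have hint : ∀ k, Integrable (fun w => q k * ∫ w', splitRate g c γ η k (w, w') ∂(slotLaw M K C))
      (slotLaw M K C) := fun k => (integrable_splitRate hg η k).integral_prod_left.const_mul _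
  calc ∑ k, q k * throughput g c γ η k =
        ∑ k, ∫ w, q k * ∫ w', splitRate g c γ η k (w, w') ∂(slotLaw M K C) ∂(slotLaw M K C) := by
        simp only [throughput_eq_integral_integral hg, integral_const_mul]
    _ = _ := (integral_finsetSum _ fun k _ => hint k).symm

theorem throughput_nonneg (η : Policy M K) (k : Fin K) : 0 ≤ throughput g c γ η k :=
  integral_nonneg fun _ => outageRate_nonneg _ _ _ ((η.feasible _ _).rate_nonneg k)

end Throughput

section Region

theorem throughput_mem_region (η : Policy M K) : throughput g c γ η ∈ region g c γ :=
  subset_closure (subset_convexHull ℝ _ (Set.mem_iUnion.2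
    ⟨η, fun k => ⟨throughput_nonneg η k, le_rfl⟩⟩))

theorem region_subset {s : Set (Fin K → ℝ)} (hs : Convex ℝ s) (hsc : IsClosed s)
    (h : ∀ (η : Policy M K) (R : Fin K → ℝ), 0 ≤ R → R ≤ throughput g c γ η → R ∈ s) :
    region g c γ ⊆ s :=
  closure_minimal (convexHull_min (Set.iUnion_subset fun η R hR =>
    h η R (fun k => (hR k).1) fun k => (hR k).2) hs) hsc

theorem region_nonneg {R : Fin K → ℝ} (hR : R ∈ region g c γ) : 0 ≤ R :=
  region_subset (convex_Ici 0) isClosed_Ici (fun _ _ hR _ => hR) hR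

theorem mul_mem_region {θ z : Fin K → ℝ} (hz : z ∈ region g c γ) (hθ0 : 0 ≤ θ) (hθ1 : θ ≤ 1) :
    θ * z ∈ region g c γ := by
  have hcont : Continuous (LinearMap.mulLeft ℝ θ) := LinearMap.continuous_on_pi _
  have hclosed : IsClosed (LinearMap.mulLeft ℝ θ ⁻¹' region g c γ) :=
    isClosed_closure.preimage hcont
  have hconvex : Convex ℝ (LinearMap.mulLeft ℝ θ ⁻¹' region g c γ) :=
    (convex_convexHull ℝ _).closure.linear_preimage _
  refine region_subset hconvex hclosed (fun η R hR0 hR => ?_) hz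
  refine subset_closure (subset_convexHull ℝ _ (Set.mem_iUnion.2 ⟨η, fun k => ?_⟩))
  exact ⟨mul_nonneg (hθ0 k) (hR0 k), (mul_le_of_le_one_left (hR0 k) (hθ1 k)).trans (hR k)⟩

theorem mem_region_of_le {z x : Fin K → ℝ} (hz : z ∈ region g c γ) (hx : 0 ≤ x) (hxz : x ≤ z) :
    x ∈ region g c γ := by
  have hz0 := region_nonneg hz
  have hx_eq : x = x / z * z := by
    ext k
    refine (div_mul_cancel_of_imp fun hzk => ?_).symm
    exact le_antisymm (hzk ▸ hxz k) (hx k)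
  rw [hx_eq]
  exact mul_mem_region hz
    (fun k => div_nonneg (hx k) (hz0 k)) fun k => div_le_one_of_le₀ (hxz k) (hz0 k)

end Region

namespace AdaptivePolicy

variable {U : (Fin K → ℝ) → EReal} {V A : ℝ} (π : AdaptivePolicy g c γ U V A)

/-- The stationary policy that uses the decisions of the adaptive policy for fixed queues. -/
def frozen (q : Fin K → ℝ) : Policy M K where
  act H _ := π.act H q
  measurable_act := π.measurable_act.comp (measurable_fst.prodMk measurable_const)
  feasible H _ := π.feasible H q

theorem max_weight (hg : ∀ k c c', 0 ≤ g k c c') {q : Fin K → ℝ} (hq : 0 ≤ q) {R : Fin K → ℝ}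
    (hR : R ∈ region g c γ) :
    ∑ k, q k * R k ≤ ∑ k, q k * throughput g c γ (π.frozen q) k := by
  have hconvex : Convex ℝ {R : Fin K → ℝ |
      ∑ k, q k * R k ≤ ∑ k, q k * throughput g c γ (π.frozen q) k} :=
    convex_halfSpace_le ⟨fun x y => by simp [mul_add, Finset.sum_add_distrib],
      fun a x => by simp [Finset.mul_sum, mul_left_comm]⟩ _
  refine region_subset hconvex (isClosed_le (by fun_prop) continuous_const)
    (fun η R _ hR => ?_) hR
  calc ∑ k, q k * R k ≤ ∑ k, q k * throughput g c γ η k :=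
        Finset.sum_le_sum fun k _ => mul_le_mul_of_nonneg_left (hR k) (hq k)
    _ = ∫ w, weightedRate g c γ (ownChannel c w) q (η.act (ownChannel c w) (w.2 c))
          ∂(slotLaw M K C) := sum_mul_throughput_eq hg η q
    _ ≤ ∫ w, weightedRate g c γ (ownChannel c w) q (π.act (ownChannel c w) q)
          ∂(slotLaw M K C) := by
        refine integral_mono_ae (integrable_weightedRate hg η q)
          (integrable_weightedRate hg (π.frozen q) q) ?_
        filter_upwards [ae_of_ae_map (measurable_ownChannel c).aemeasurable π.act_optimal] with w hw
        exact hw q hq _ (η.feasible _ _)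
    _ = ∑ k, q k * throughput g c γ (π.frozen q) k :=
        (sum_mul_throughput_eq hg (π.frozen q) q).symm

section QueueSystem

variable (hg : ∀ k c c', 0 ≤ g k c c')
  (hU_top : ∀ x : Fin K → ℝ, 0 ≤ x → U x ≠ ⊤) (hU_cont : ContinuousOn U (Set.Ici 0))
  (hU_conc : ConcaveOnOrthant U) (hU_mono : MonotoneOn U (Set.Ici 0)) (hV : 0 < V) (hA : 0 < A)

/-- The virtual queues of the adaptive policy as an abstract queueing system, driven by the
slots. -/
noncomputable def toQueueSystem : QueueSystem K (Slot M K C) where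
  law := slotLaw M K C
  isProbabilityMeasure_law := inferInstance
  rate q w k := outageRate (g k c c) (ownChannel c w) (ici g c γ w k) (π.act (ownChannel c w) q) k
  arrival := π.arrival
  rateBound w k := infoBound (g k c c) (w.1 k c c) (ici g c γ w k)
  region := region g c γ
  U := U
  V := V
  A := A
  measurable_rate := measurable_pi_lambda _ fun k =>
    have hown : Measurable fun p : (Fin K → ℝ) × Slot M K C => ownChannel c p.2 :=
      (measurable_ownChannel c).comp measurable_snd
    measurable_outageRate hown ((measurable_ici g c γ k).comp measurable_snd)
      (π.measurable_act.comp (hown.prodMk measurable_fst)) _ k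
  measurable_arrival := π.measurable_arrival
  measurable_rateBound := measurable_pi_lambda _ (measurable_infoBound g c γ)
  rate_nonneg q _ k := outageRate_nonneg _ _ _ ((π.feasible _ q).rate_nonneg k)
  rate_le q w k :=
    outageRate_le_infoBound (hg _ _ _) (ici_nonneg hg c γ w k) _ (π.feasible _ q) k
  integrable_rateBound_pow_four := integrable_infoBound_pow_four hg
  V_pos := hV
  A_pos := hA
  U_ne_top := hU_top
  continuousOn_U := hU_cont
  concaveOn_U := hU_conc
  monotoneOn_U := hU_mono
  isClosed_region := isClosed_closure
  convex_region := (convex_convexHull ℝ _).closure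
  region_nonneg _ hz := region_nonneg hz
  region_lower _ hz _ hx hxz := mem_region_of_le hz hx hxz
  arrival_mem := π.arrival_mem
  arrival_optimal := π.arrival_optimal
  max_weight _ hq _ hR := π.max_weight hg hq hR
  mean_rate_mem q := throughput_mem_region (π.frozen q)

theorem toQueueSystem_queue (q₀ : Fin K → ℝ) (w : ℕ → Slot M K C) (t : ℕ) :
    (π.toQueueSystem hg hU_top hU_cont hU_conc hU_mono hV hA).queue q₀ w t = π.queue q₀ w t := by
  induction t with
  | zero => rfl
  | succ t ih =>
    change QueueSystem.step _ (QueueSystem.queue _ q₀ w t) (w t) = _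
    rw [ih]
    rfl

theorem half_integral_incr_toQueueSystem :
    1 / 2 * ∫ w, (π.toQueueSystem hg hU_top hU_cont hU_conc hU_mono hV hA).incr w
      ∂(slotLaw M K C) = kappa g c γ A := by
  set N := π.toQueueSystem hg hU_top hU_cont hU_conc hU_mono hV hA
  have hsq : ∀ k, Integrable (fun w => N.rateBound w k ^ 2) (slotLaw M K C) :=
    N.integrable_rateBound_sq
  have hadd : ∀ k, ∫ w, (A ^ 2 + N.rateBound w k ^ 2) ∂(slotLaw M K C) =
      A ^ 2 + ∫ w, N.rateBound w k ^ 2 ∂(slotLaw M K C) := fun k => by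
    rw [integral_add (integrable_const _) (hsq k), integral_const, probReal_univ, one_smul]
  have hsum : ∫ w, N.incr w ∂(slotLaw M K C) =
      K * A ^ 2 + ∑ k, ∫ w, N.rateBound w k ^ 2 ∂(slotLaw M K C) := by
    refine (integral_finsetSum _ fun k _ => (integrable_const _).add (hsq k)).trans
      ((Finset.sum_congr rfl fun k _ => hadd k).trans ?_)
    rw [Finset.sum_add_distrib, Finset.sum_const, Finset.card_univ, Fintype.card_fin, nsmul_eq_mul]
  rw [hsum]
  rfl

end QueueSystem

end AdaptivePolicy

end MultiCell

theorem theorem2_general {M K C : ℕ}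
    (g : Fin K → Fin C → Fin C → ℝ) (hg : ∀ k c c', 0 ≤ g k c c')
    (c : Fin C) (γ : {c' : Fin C // c' ≠ c} → MultiCell.Policy M K)
    (U : (Fin K → ℝ) → EReal)
    (hU_top : ∀ x : Fin K → ℝ, 0 ≤ x → U x ≠ ⊤)
    (hU_cont : ContinuousOn U (Set.Ici 0))
    (hU_conc : MultiCell.ConcaveOnOrthant U)
    (hU_mono : MonotoneOn U (Set.Ici 0))
    (hr : ∃ r ∈ MultiCell.region g c γ, ∀ k, 0 < r k)
    (V A : ℝ) (hV : 0 < V) (hA : 0 < A)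
    (π : MultiCell.AdaptivePolicy g c γ U V A) (q₀ : Fin K → ℝ) (hq₀ : 0 ≤ q₀)
    {Ω : Type*} [MeasurableSpace Ω] (μ : Measure Ω) [IsProbabilityMeasure μ]
    (W : ℕ → Ω → MultiCell.Slot M K C) (hW_meas : ∀ t, Measurable (W t))
    (hW_law : ∀ t, μ.map (W t) = MultiCell.slotLaw M K C)
    (hW_indep : iIndepFun W μ) :
    (∃ Rs, MultiCell.IsBoxOptimal g c γ U A Rs) ∧
    (∀ t k, Integrable (fun ω => π.queue q₀ (fun s => W s ω) t k) μ) ∧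
    ∀ Rs, MultiCell.IsBoxOptimal g c γ U A Rs →
      (∀ᵐ ω ∂μ,
        U Rs - ((MultiCell.kappa g c γ A / V : ℝ) : EReal) ≤
          liminf (fun t : ℕ => U ((1 / (t : ℝ)) •
            ∑ τ ∈ Finset.Icc 1 t, π.rate q₀ (fun s => W s ω) τ)) atTop) ∧
      (U Rs ≠ ⊥ →
        (∀ R ∈ MultiCell.region g c γ ∩ MultiCell.box K A, ∀ β : ℝ, 0 ≤ β → β < 1 →
          limsup (fun t : ℕ => (((1 / (t : ℝ)) * ∑ τ ∈ Finset.Icc 1 t, ∑ k,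
              R k * ∫ ω, π.queue q₀ (fun s => W s ω) τ k ∂μ : ℝ) : EReal)) atTop ≤
            (((MultiCell.kappa g c γ A : ℝ) : EReal) + (V : EReal) * (U Rs - U (β • R))) /
              ((1 - β : ℝ) : EReal)) ∧
        ∀ k, MultiCell.StronglyStable μ
          (fun t ω => π.queue q₀ (fun s => W s ω) t k)) := by
  set N := π.toQueueSystem hg hU_top hU_cont hU_conc hU_mono hV hA
  have hqueue : ∀ (w : ℕ → MultiCell.Slot M K C) t, N.queue q₀ w t = π.queue q₀ w t :=
    π.toQueueSystem_queue hg hU_top hU_cont hU_conc hU_mono hV hA q₀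
  have hkappa : 1 / 2 * ∫ w, N.incr w ∂N.law = MultiCell.kappa g c γ A :=
    π.half_integral_incr_toQueueSystem hg hU_top hU_cont hU_conc hU_mono hV hA
  have hW : MultiCell.IsIID W N.law μ := ⟨hW_meas, hW_law, hW_indep⟩
  obtain ⟨r, hr, hr0⟩ := hr
  refine ⟨N.exists_optimal ⟨r, hr⟩, fun t k => ?_, fun Rs ⟨hRs, hopt⟩ => ?_⟩
  · simpa only [hqueue] using (N.integrable_queue hW_meas hq₀ t).eval k
  by_cases hURs : U Rs = ⊥
  · exact ⟨by simp [hURs], fun h => absurd hURs h⟩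
  obtain ⟨D, hD0, hD⟩ := N.exists_quarticDrift hr hr0 hRs hURs
  refine ⟨?_, fun _ => ⟨fun R hR β hβ0 hβ1 => ?_, fun k => ?_⟩⟩
  · have hutility := N.ae_le_liminf_utility hW hq₀ hD0 hD hRs hURs
    simp only [hkappa, hqueue] at hutility
    exact hutility
  · have hβR := MultiCell.smul_mem_box hR.2 hβ0 hβ1.le
    have hbound := N.limsup_timeAverage_integral_queue_le hW hq₀ hD0 hD hRs hURs hopt hR.1 hβ1 hβR
    simp only [hkappa, hqueue] at hbound
    exact hbound
  · simpa only [hqueue] using N.stronglyStable_queue hW hq₀ hD k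

theorem theorem2 {M K C : ℕ} (hC : 1 < C)
    (g : Fin K → Fin C → Fin C → ℝ) (hg : ∀ k c c', 0 ≤ g k c c')
    (c : Fin C) (γ : {c' : Fin C // c' ≠ c} → MultiCell.Policy M K)
    -- the utility function, with values in `[-∞, ∞)` on the non-negative orthant
    (U : (Fin K → ℝ) → EReal)
    (hU_top : ∀ x : Fin K → ℝ, 0 ≤ x → U x ≠ ⊤)
    (hU_cont : ContinuousOn U (Set.Ici 0))
    (hU_conc : MultiCell.ConcaveOnOrthant U)
    (hU_mono : MonotoneOn U (Set.Ici 0))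
    (hr : ∃ r ∈ MultiCell.region g c γ, (∀ k, 0 < r k) ∧ U ((1 / 2 : ℝ) • r) ≠ ⊥)
    (V A : ℝ) (hV : 0 < V) (hA : 0 < A)
    (π : MultiCell.AdaptivePolicy g c γ U V A) (q₀ : Fin K → ℝ) (hq₀ : 0 ≤ q₀)
    -- the slots are i.i.d.
    {Ω : Type*} [MeasurableSpace Ω] (μ : Measure Ω) [IsProbabilityMeasure μ]
    (W : ℕ → Ω → MultiCell.Slot M K C) (hW_meas : ∀ t, Measurable (W t))
    (hW_law : ∀ t, μ.map (W t) = MultiCell.slotLaw M K C)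
    (hW_indep : iIndepFun W μ) :
    -- the optimization problem restricted to the box has a solution
    (∃ Rs, MultiCell.IsBoxOptimal g c γ U A Rs) ∧
    -- the queue sizes have finite expectations
    (∀ t k, Integrable (fun ω => π.queue q₀ (fun s => W s ω) t k) μ) ∧
    ∀ Rs, MultiCell.IsBoxOptimal g c γ U A Rs →
      -- (a)
      (∀ᵐ ω ∂μ,
        U Rs - ((MultiCell.kappa g c γ A / V : ℝ) : EReal) ≤
          liminf (fun t : ℕ => U ((1 / (t : ℝ)) •
            ∑ τ ∈ Finset.Icc 1 t, π.rate q₀ (fun s => W s ω) τ)) atTop) ∧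
      (U Rs ≠ ⊥ →
        -- (b)
        (∀ R ∈ MultiCell.region g c γ ∩ MultiCell.box K A, ∀ β : ℝ, 0 ≤ β → β < 1 →
          limsup (fun t : ℕ => (((1 / (t : ℝ)) * ∑ τ ∈ Finset.Icc 1 t, ∑ k,
              R k * ∫ ω, π.queue q₀ (fun s => W s ω) τ k ∂μ : ℝ) : EReal)) atTop ≤
            (((MultiCell.kappa g c γ A : ℝ) : EReal) + (V : EReal) * (U Rs - U (β • R))) /
              ((1 - β : ℝ) : EReal)) ∧
        ∀ k, MultiCell.StronglyStable μ
          (fun t ω => π.queue q₀ (fun s => W s ω) t k)) := by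
  obtain ⟨r, hr, hr0, -⟩ := hr
  exact theorem2_general g hg c γ U hU_top hU_cont hU_conc hU_mono ⟨r, hr, hr0⟩ V A hV hA π q₀ hq₀
    μ W hW_meas hW_law hW_indep
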